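/- All Hilbert spaces are complex, and self-adjoint operators may be unbounded unless they are said to be bounded. For a continuous function $f:\mathbb R\to\mathbb C$ and a self-adjoint operator $A$ with spectral measure $E_A$, let $f(A)=\int f\,dE_A$, with domain $\{u:\int|f|^2\,d\langle E_Au,u\rangle<\infty\}$. For densely defined operators $S,T$ on the same space put $\|S-T\|=\|K\|$ if $S=T+K$ for an everywhere defined bounded operator $K$ (in particular $S$ and $T$ have the same domain), and $\|S-T\|=\infty$ if there is no such $K$. The function $f$ is called *operator continuous* if for every self-adjoint operator $A$ on any Hilbert space and every $\varepsilon>0$ there is $\delta>0$ such that $\|f(B)-f(A)\|<\varepsilon$ for every self-adjoint operator $B$ on the same space with $\|B-A\|<\delta$. It is called *uniformly operator continuous* if for every $\varepsilon>0$ there is $\delta>0$ such that $\|f(A)-f(B)\|<\varepsilon$ for all bounded self-adjoint operators $A,B$ on any common Hilbert space with $\|A-B\|<\delta$. The *operator modulus of continuity* of $f$ is $$\Omega_f(\delta)=\sup\|f(A)-f(B)\|\in[0,\infty],\qquad \delta\ge 0,$$ the supremum being over all bounded self-adjoint operators $A,B$ on any common Hilbert space with $\|A-B\|\le\delta$. **Corollary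 8.7.** Let $f:\mathbb R\to\mathbb C$ be continuous. 1. $f$ is operator continuous if and only if it is uniformly operator continuous. 2. If $f$ is bounded and uniformly continuous, then $f$ is uniformly operator continuous. 3. If $A$ and $B$ are self-adjoint operators, not necessarily bounded, on the same Hilbert space and $A-B$ is bounded (that is, $A=B+K$ with $K$ bounded and everywhere defined), then $\|f(A)-f(B)\|\le\Omega_f(\|A-B\|)$. -/

import Mathlib

open scoped ENNReal

universe u

noncomputable section

namespace OperatorModulus

variable {H : Type u} [NormedAddCommGroup H] [InnerProductSpace ℂ H] [CompleteSpace H]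

/-! ### The resolvent `(A + i)⁻¹` of an unbounded self-adjoint operator

Unbounded operators are Mathlib's partially defined linear maps `H →ₗ.[ℂ] H`, and `IsSelfAdjoint A`
means `A† = A` (equality of domains included; it forces the domain to be dense). -/

/-- `R` is the resolvent `(A + i)⁻¹`: for every `y`, `R y` lies in the domain of `A` and
`(A + i) (R y) = y`. -/
def IsResolvent (A : H →ₗ.[ℂ] H) (R : H →L[ℂ] H) : Prop :=
  ∀ y : H, ∃ x : A.domain, (x : H) = R y ∧ A x + Complex.I • (x : H) = y

theorem symm_inner {A : H →ₗ.[ℂ] H} (hA : IsSelfAdjoint A) (x y : A.domain) :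
    inner ℂ (A x) (y : H) = inner ℂ (x : H) (A y) := by
  have h := LinearPMap.adjoint_isFormalAdjoint (T := A) hA.dense_domain
  rw [LinearPMap.isSelfAdjoint_def.mp hA] at h
  exact h x y

theorem norm_le_norm_add_I {A : H →ₗ.[ℂ] H} (hA : IsSelfAdjoint A) (x : A.domain) :
    ‖(x : H)‖ ≤ ‖A x + Complex.I • (x : H)‖ := by
  have h1 : (inner ℂ (A x) (x : H)).im = 0 := by
    have h := symm_inner hA x x
    have h2 := inner_conj_symm (𝕜 := ℂ) (A x) (x : H)
    rw [← h] at h2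
    exact Complex.conj_eq_iff_im.mp h2
  have h3 := norm_add_sq (𝕜 := ℂ) (A x) (Complex.I • (x : H))
  have h4 : RCLike.re (inner ℂ (A x) (Complex.I • (x : H))) = 0 := by
    rw [inner_smul_right]
    simp [h1]
  rw [h4, norm_smul, Complex.norm_I, one_mul] at h3
  exact le_of_sq_le_sq (by nlinarith [sq_nonneg ‖A x‖]) (norm_nonneg _)

/-- The linear map `A + i` on the domain of `A`. -/
def addI (A : H →ₗ.[ℂ] H) : A.domain →ₗ[ℂ] H :=
  A.toFun + Complex.I • A.domain.subtype

theorem addI_injective {A : H →ₗ.[ℂ] H} (hA : IsSelfAdjoint A) :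
    Function.Injective (addI A) := by
  rw [injective_iff_map_eq_zero]
  intro x hx
  have h := norm_le_norm_add_I hA x
  have hx' : A x + Complex.I • (x : H) = 0 := hx
  rw [hx', norm_zero, norm_le_zero_iff] at h
  exact Subtype.ext h

theorem addI_surjective {A : H →ₗ.[ℂ] H} (hA : IsSelfAdjoint A) :
    Function.Surjective (addI A) := by
  have hcl : IsClosed ((LinearMap.range (addI A) : Submodule ℂ H) : Set H) := by
    apply isClosed_of_closure_subset
    intro y hy
    obtain ⟨s, hs, hlim⟩ := mem_closure_iff_seq_limit.mp hy
    choose x hx using hs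
    have hx' : ∀ n, A (x n) + Complex.I • (x n : H) = s n := hx
    have hc : CauchySeq (fun n => (x n : H)) := by
      have hsc := hlim.cauchySeq
      rw [Metric.cauchySeq_iff] at hsc ⊢
      intro ε hε
      obtain ⟨N, hN⟩ := hsc ε hε
      refine ⟨N, fun m hm n hn => lt_of_le_of_lt ?_ (hN m hm n hn)⟩
      rw [dist_eq_norm, dist_eq_norm, ← hx, ← hx, ← map_sub]
      exact norm_le_norm_add_I hA (x m - x n)
    obtain ⟨z, hz⟩ := cauchySeq_tendsto_of_complete hc
    have hAz : Filter.Tendsto (fun n => A (x n)) Filter.atTop (nhds (y - Complex.I • z)) := by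
      have : (fun n => A (x n)) = fun n => s n - Complex.I • (x n : H) := by
        funext n
        rw [← hx' n, add_sub_cancel_right]
      rw [this]
      exact hlim.sub (hz.const_smul _)
    have hg : (z, y - Complex.I • z) ∈ A.graph := by
      have hA' : IsClosed (A.graph : Set (H × H)) := hA.isClosed
      exact hA'.mem_of_tendsto (hz.prodMk_nhds hAz)
        (Filter.Eventually.of_forall fun n => A.mem_graph (x n))
    obtain ⟨w, hw1, hw2⟩ := (LinearPMap.mem_graph_iff A).mp hg
    refine ⟨w, ?_⟩
    change A w + Complex.I • (w : H) = y
    rw [hw2, hw1]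
    simp
  have hperp : (LinearMap.range (addI A))ᗮ = ⊥ := by
    rw [Submodule.eq_bot_iff]
    intro y hy
    have hy' : ∀ x : A.domain, inner ℂ y (A x + Complex.I • (x : H)) = 0 := fun x =>
      (Submodule.mem_orthogonal' _ _).mp hy _ ⟨x, rfl⟩
    have key : ∀ x : A.domain, inner ℂ (Complex.I • y) (x : H) = inner ℂ y (A x) := by
      intro x
      have h := hy' x
      rw [inner_add_right, inner_smul_right] at h
      rw [inner_smul_left, Complex.conj_I]
      linear_combination -h
    have hmem : y ∈ A.adjoint.domain := LinearPMap.mem_adjoint_domain_of_exists y ⟨_, key⟩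
    have happ : A.adjoint ⟨y, hmem⟩ = Complex.I • y :=
      LinearPMap.adjoint_apply_eq hA.dense_domain _ key
    have hgr : (y, Complex.I • y) ∈ A.graph := by
      have : (y, Complex.I • y) ∈ A.adjoint.graph :=
        (LinearPMap.mem_graph_iff _).mpr ⟨⟨y, hmem⟩, rfl, happ⟩
      rwa [LinearPMap.isSelfAdjoint_def.mp hA] at this
    obtain ⟨w, hw1, hw2⟩ := (LinearPMap.mem_graph_iff A).mp hgr
    have h := hy' w
    simp only at hw1 hw2
    rw [hw2, hw1, inner_add_right, inner_smul_right] at h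
    have h2 : inner ℂ y y = (0 : ℂ) := by
      have h3 : (2 * Complex.I) * inner ℂ y y = 0 := by linear_combination h
      exact (mul_eq_zero.mp h3).resolve_left (by simp)
    exact inner_self_eq_zero.mp h2
  have htop : LinearMap.range (addI A) = ⊤ := by
    have : CompleteSpace (LinearMap.range (addI A)) := hcl.completeSpace_coe
    exact Submodule.orthogonal_eq_bot_iff.mp hperp
  exact LinearMap.range_eq_top.mp htop

/-- Existence and uniqueness of the resolvent `(A + i)⁻¹` of a self-adjoint operator. -/
theorem existsUnique_isResolvent {A : H →ₗ.[ℂ] H} (hA : IsSelfAdjoint A) :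
    ∃! R : H →L[ℂ] H, IsResolvent A R := by
  let e := LinearEquiv.ofBijective (addI A) ⟨addI_injective hA, addI_surjective hA⟩
  have he : ∀ y, A (e.symm y) + Complex.I • (e.symm y : H) = y := fun y => e.apply_symm_apply y
  refine ⟨LinearMap.mkContinuous (A.domain.subtype ∘ₗ e.symm.toLinearMap) 1 ?_, ?_, ?_⟩
  · intro y
    have h := norm_le_norm_add_I hA (e.symm y)
    rw [he] at h
    simpa using h
  · exact fun y => ⟨e.symm y, rfl, he y⟩
  · intro R hR
    ext y
    obtain ⟨x, hx, hxy⟩ := hR y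
    have : x = e.symm y := e.injective ((e.apply_symm_apply y).symm ▸ hxy)
    rw [← hx, this]
    rfl

/-- The bounded normal operator `(A + i)⁻¹`. -/
def resolventI (A : H →ₗ.[ℂ] H) (hA : IsSelfAdjoint A) : H →L[ℂ] H :=
  (existsUnique_isResolvent hA).choose

/-! ### Functions of self-adjoint operators -/

/-- `h(A)` for a self-adjoint, possibly unbounded, `A` and a continuous function `h` on `ℝ`
vanishing at infinity. Writing `h(t) = g((t + i)⁻¹)` with `g(0) = 0`, this is `g((A + i)⁻¹)`, where
`g` is applied to the bounded normal operator `(A + i)⁻¹` by the continuous functional calculus. -/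
def fcVanishing (h : ℝ → ℂ) (A : H →ₗ.[ℂ] H) (hA : IsSelfAdjoint A) : H →L[ℂ] H :=
  cfc (fun w : ℂ => if w = 0 then 0 else h (w⁻¹).re) (resolventI A hA)

/-- The continuous cut-off function equal to `1` on `[-n, n]` and to `0` off `[-n-1, n+1]`. -/
def cutoff (n : ℕ) (t : ℝ) : ℝ := max 0 (min 1 ((n : ℝ) + 1 - |t|))

/-- The bounded operators `(φₙ f)(A)`, where `φₙ` is the cut-off function. -/
def truncated (f : C(ℝ, ℂ)) (A : H →ₗ.[ℂ] H) (hA : IsSelfAdjoint A) (n : ℕ) : H →L[ℂ] H :=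
  fcVanishing (fun t => (cutoff n t : ℂ) * f t) A hA

/-- The operator `f(A)` for a self-adjoint, possibly unbounded, operator `A` and a continuous,
possibly unbounded, function `f`: the operator `f(A) u = lim (φₙ f)(A) u`, whose domain consists of
all the vectors `u` for which this limit exists in norm. In terms of the spectral measure `E` of
`A`, this is the operator `∫ f dE` with domain `{u | ∫ |f|² d⟨E u, u⟩ < ∞}`. -/
def fc (f : C(ℝ, ℂ)) (A : H →ₗ.[ℂ] H) (hA : IsSelfAdjoint A) : H →ₗ.[ℂ] H where
  domain :=
    { carrier := {u | ∃ v, Filter.Tendsto (fun n => truncated f A hA n u) Filter.atTop (nhds v)}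
      zero_mem' := ⟨0, by simp⟩
      add_mem' := by
        rintro a b ⟨v, hv⟩ ⟨w, hw⟩
        exact ⟨v + w, by simpa using hv.add hw⟩
      smul_mem' := by
        rintro c a ⟨v, hv⟩
        exact ⟨c • v, by simpa using hv.const_smul c⟩ }
  toFun :=
    { toFun := fun u => u.2.choose
      map_add' := fun a b => tendsto_nhds_unique (a + b).2.choose_spec
        (by simpa using a.2.choose_spec.add b.2.choose_spec)
      map_smul' := fun c a => tendsto_nhds_unique (c • a).2.choose_spec
        (by simpa using a.2.choose_spec.const_smul c) }

/-- `f(A)` for a bounded self-adjoint operator `A`, by Mathlib's continuous functional calculus. -/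
def fcBounded (f : C(ℝ, ℂ)) (A : H →L[ℂ] H) : H →L[ℂ] H :=
  cfc (fun z : ℂ => f z.re) A

/-- The norm `‖S - T‖` of the difference of two densely defined operators: it is `‖K‖` if
`S = T + K` with an everywhere defined bounded operator `K` (so that `S` and `T` have the same
domain), and `∞` if there is no such `K`. -/
def normDiff (S T : H →ₗ.[ℂ] H) : ℝ≥0∞ :=
  ⨅ (K : H →L[ℂ] H) (_ : S = (K : H →ₗ[ℂ] H) +ᵥ T), ‖K‖ₑ

/-- `f` is operator continuous: `A ↦ f(A)` is continuous at every, possibly unbounded, self-adjoint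
operator `A` on every complex Hilbert space. -/
def OperatorContinuous (f : C(ℝ, ℂ)) : Prop :=
  ∀ (H : Type u) [NormedAddCommGroup H] [InnerProductSpace ℂ H] [CompleteSpace H]
    (A : H →ₗ.[ℂ] H) (hA : IsSelfAdjoint A),
    ∀ ε : ℝ≥0∞, 0 < ε → ∃ δ : ℝ≥0∞, 0 < δ ∧
      ∀ (B : H →ₗ.[ℂ] H) (hB : IsSelfAdjoint B),
        normDiff B A < δ → normDiff (fc f B hB) (fc f A hA) < ε

/-- `f` is uniformly operator continuous: `A ↦ f(A)` is uniformly continuous on the bounded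
self-adjoint operators, with `δ` depending on `ε` only. -/
def UniformlyOperatorContinuous (f : C(ℝ, ℂ)) : Prop :=
  ∀ ε : ℝ, 0 < ε → ∃ δ : ℝ, 0 < δ ∧
    ∀ (H : Type u) [NormedAddCommGroup H] [InnerProductSpace ℂ H] [CompleteSpace H]
      (A B : H →L[ℂ] H), IsSelfAdjoint A → IsSelfAdjoint B →
        ‖A - B‖ < δ → ‖fcBounded f A - fcBounded f B‖ < ε

/-- The operator modulus of continuity `Ω_f(δ)`, possibly infinite: the supremum of
`‖f(A) - f(B)‖` over all bounded self-adjoint `A` and `B` with `‖A - B‖ ≤ δ`. -/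
def operatorModulus (f : C(ℝ, ℂ)) (δ : ℝ) : ℝ≥0∞ :=
  ⨆ (H : Type u) (_ : NormedAddCommGroup H) (_ : InnerProductSpace ℂ H) (_ : CompleteSpace H)
    (A : H →L[ℂ] H) (B : H →L[ℂ] H) (_ : IsSelfAdjoint A) (_ : IsSelfAdjoint B)
    (_ : ‖A - B‖ ≤ δ), ‖fcBounded f A - fcBounded f B‖ₑ

end OperatorModulus

end

/-! Everything reduces to the bounded normal operator `R = (A + i)⁻¹`. Its spectrum lies on a fixed
compact circle, and `φₙ f`, read in the variable `w = (t + i)⁻¹`, is continuous there, so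
Stone–Weierstrass turns strong resolvent convergence into strong convergence of the truncations
(`tendsto_cfc_apply`).

Let `A = B + K`, and suppose `‖f(S) - f(T)‖ ≤ ω` for all bounded self-adjoint `S`, `T` with `S - T =
K`. Take `Tₙ = (φₙ t)(B)` and `Sₙ = K + Tₙ`, which converge to `B` and `A` in the strong resolvent
sense. Since `φₘ(S)(f(S) - f(T))φₖ(T)` involves truncations only, its bound `ω` survives the limit
(`norm_truncRes_commutator_le`). Removing the cut-offs by a monotonicity argument
(`exists_tendsto_truncRes`) gives equal domains and `‖f(A) - f(B)‖ ≤ ω`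
(`normDiff_fc_le_of_forall`). This yields the modulus estimate and the passage from uniform to
pointwise operator continuity.

Conversely, if uniform operator continuity fails, bad pairs `(Aₙ, Bₙ)` with `‖Aₙ - Bₙ‖ < 1/(n+1)`
exist. Replacing one far summand of `⊕ Aₙ` by `Bₙ` is an arbitrarily small perturbation that moves
`f` by at least `ε`, so operator continuity fails at `⊕ Aₙ`.

A bounded uniformly continuous `f` is a uniform limit of its Poisson integrals. These are operator
Lipschitz by the resolvent identity, Cauchy–Schwarz, and the fact that the Poisson kernels of an
operator integrate to `π` times the identity (`norm_cfc_poisson_sub_le`). -/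

noncomputable section
namespace OperatorModulus

variable {H : Type u} [NormedAddCommGroup H] [InnerProductSpace ℂ H] [CompleteSpace H]

open Filter Topology

/-! ### The circle carrying the spectra of resolvents -/

/-- The image of the extended real line under `t ↦ (t + i)⁻¹`. -/
def resolventCircle : Set ℂ := {w | w - star w + 2 * Complex.I * (star w * w) = 0}

/-- This is the circle of centre `-i/2` and radius `1/2`. The defining equation is kept in the form
`w - w̄ + 2i w̄w = 0` because a resolvent satisfies its operator analogue `R - R* + 2i R*R = 0`. -/
theorem mem_resolventCircle_iff {w : ℂ} :
    w ∈ resolventCircle ↔ w.re ^ 2 + w.im ^ 2 = -w.im := by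
  simp only [resolventCircle, Set.mem_ofPred_eq, Complex.ext_iff]
  simp
  constructor
  · intro h; nlinarith [h.2]
  · intro h; constructor <;> nlinarith

theorem inv_add_I_mem_resolventCircle (t : ℝ) : ((t : ℂ) + Complex.I)⁻¹ ∈ resolventCircle := by
  rw [mem_resolventCircle_iff, Complex.inv_re, Complex.inv_im]
  have h : Complex.normSq ((t : ℂ) + Complex.I) = t ^ 2 + 1 := by
    simp [Complex.normSq_apply]; ring
  rw [h]
  have : t ^ 2 + 1 ≠ 0 := by positivity
  simp
  field_simp

theorem exists_eq_inv_add_I {w : ℂ} (hw : w ∈ resolventCircle) (h0 : w ≠ 0) :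
    w = (((w⁻¹).re : ℂ) + Complex.I)⁻¹ := by
  rw [eq_comm, inv_eq_iff_eq_inv]
  rw [mem_resolventCircle_iff] at hw
  have h1 : Complex.normSq w ≠ 0 := by simpa using h0
  apply Complex.ext
  · simp
  · rw [Complex.inv_im]
    rw [Complex.normSq_apply] at h1 ⊢
    simp only [Complex.add_im, Complex.ofReal_im, Complex.I_im, zero_add]
    rw [eq_div_iff h1]
    linarith

theorem norm_le_one_of_mem_resolventCircle {w : ℂ} (hw : w ∈ resolventCircle) : ‖w‖ ≤ 1 := by
  rw [mem_resolventCircle_iff] at hw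
  have h : ‖w‖ ^ 2 ≤ 1 ^ 2 := by
    rw [Complex.sq_norm, Complex.normSq_apply]
    nlinarith [sq_nonneg w.re, sq_nonneg w.im]
  exact le_of_sq_le_sq h zero_le_one

theorem isCompact_resolventCircle : IsCompact resolventCircle := by
  apply Metric.isCompact_of_isClosed_isBounded
  · exact isClosed_eq (by fun_prop) continuous_const
  · exact (Metric.isBounded_closedBall (x := (0 : ℂ)) (r := 1)).subset fun w hw => by
      simpa using norm_le_one_of_mem_resolventCircle hw

/-! ### Truncations as functions of the resolvent -/

theorem continuous_cutoff (n : ℕ) : Continuous (cutoff n) := by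
  unfold cutoff; fun_prop

theorem cutoff_nonneg (n : ℕ) (t : ℝ) : 0 ≤ cutoff n t := le_max_left _ _

theorem cutoff_le_one (n : ℕ) (t : ℝ) : cutoff n t ≤ 1 :=
  max_le zero_le_one (min_le_left _ _)

theorem cutoff_eq_zero {n : ℕ} {t : ℝ} (h : (n : ℝ) + 1 ≤ |t|) : cutoff n t = 0 :=
  max_eq_left (min_le_iff.mpr (Or.inr (by linarith)))

theorem cutoff_eq_one {n : ℕ} {t : ℝ} (h : |t| ≤ n) : cutoff n t = 1 := by
  unfold cutoff
  rw [min_eq_left (by linarith), max_eq_right zero_le_one]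

/-- The ramp of `cutoff k` ends at `k + 1`, where `cutoff m` is still `1`. This is why nested
cut-offs below always need a gap of one. -/
theorem cutoff_mul_cutoff {k m : ℕ} (h : k + 1 ≤ m) (t : ℝ) :
    cutoff m t * cutoff k t = cutoff k t := by
  by_cases ht : (k : ℝ) + 1 ≤ |t|
  · rw [cutoff_eq_zero ht, mul_zero]
  · have h' : (k : ℝ) + 1 ≤ m := by exact_mod_cast h
    rw [cutoff_eq_one (by linarith), one_mul]

/-- The function `(φₙ f)(t)` written in the variable `w = (t + i)⁻¹`. -/
def truncFun (f : C(ℝ, ℂ)) (n : ℕ) (w : ℂ) : ℂ :=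
  if w = 0 then 0 else (cutoff n (w⁻¹).re : ℂ) * f (w⁻¹).re

theorem truncFun_inv_add_I (f : C(ℝ, ℂ)) (n : ℕ) (t : ℝ) :
    truncFun f n ((t : ℂ) + Complex.I)⁻¹ = (cutoff n t : ℂ) * f t := by
  have h : (t : ℂ) + Complex.I ≠ 0 := fun h => by simpa using congrArg Complex.im h
  rw [truncFun, if_neg (inv_ne_zero h), inv_inv]
  simp

theorem truncFun_zero (f : C(ℝ, ℂ)) (n : ℕ) : truncFun f n 0 = 0 := if_pos rfl

theorem sq_re_inv_add_one {w : ℂ} (hw : w ∈ resolventCircle) (h0 : w ≠ 0) :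
    ‖w‖ ^ 2 * ((w⁻¹).re ^ 2 + 1) = 1 := by
  have h := exists_eq_inv_add_I hw h0
  have h1 : w⁻¹ = ((w⁻¹).re : ℂ) + Complex.I := by
    conv_lhs => rw [h, inv_inv]
  have h2 : ‖w⁻¹‖ ^ 2 = (w⁻¹).re ^ 2 + 1 := by
    conv_lhs => rw [h1]
    rw [Complex.sq_norm, Complex.normSq_apply]
    simp; ring
  rw [← h2, norm_inv, ← mul_pow, mul_inv_cancel₀ (norm_ne_zero_iff.mpr h0), one_pow]

theorem norm_le_of_cutoff_ne_one {w : ℂ} (hw : w ∈ resolventCircle) {n : ℕ}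
    (h : (n : ℝ) ≤ |(w⁻¹).re|) : ‖w‖ ^ 2 * ((n : ℝ) ^ 2 + 1) ≤ 1 := by
  by_cases h0 : w = 0
  · simp [h0]
  refine le_of_le_of_eq ?_ (sq_re_inv_add_one hw h0)
  rw [← sq_abs (w⁻¹).re]
  gcongr

theorem continuousOn_truncFun (f : C(ℝ, ℂ)) (n : ℕ) :
    ContinuousOn (truncFun f n) resolventCircle := by
  intro w hw
  by_cases h0 : w = 0
  · subst h0
    have h : truncFun f n =ᶠ[𝓝[resolventCircle] 0] fun _ => (0 : ℂ) := by
      -- The point `w = 0` corresponds to `t = ∞`. Since `|w|² (t² + 1) = 1`, this radius forces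
      -- `|t| ≥ n + 1`, so the truncation vanishes near `0`.
      have hb : Metric.ball (0 : ℂ) (1 / ((n : ℝ) + 2)) ∈ 𝓝[resolventCircle] (0 : ℂ) :=
        mem_nhdsWithin_of_mem_nhds (Metric.ball_mem_nhds _ (by positivity))
      filter_upwards [hb, self_mem_nhdsWithin] with z hz hzc
      unfold truncFun
      split_ifs with hz0
      · rfl
      rw [cutoff_eq_zero, Complex.ofReal_zero, zero_mul]
      by_contra! hlt
      have h1 := sq_re_inv_add_one hzc hz0
      rw [mem_ball_zero_iff, lt_div_iff₀ (by positivity)] at hz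
      rw [← sq_abs (z⁻¹).re] at h1
      have h2 : |(z⁻¹).re| ^ 2 + 1 < ((n : ℝ) + 2) ^ 2 := by
        nlinarith [abs_nonneg (z⁻¹).re]
      have h3 : (‖z‖ * ((n : ℝ) + 2)) ^ 2 < 1 := by
        rw [sq_lt_one_iff₀ (by positivity)]; exact hz
      rw [mul_pow] at h3
      nlinarith [mul_le_mul_of_nonneg_left h2.le (sq_nonneg ‖z‖)]
    exact continuousWithinAt_const.congr_of_eventuallyEq h (truncFun_zero f n)
  · have h1 : truncFun f n =ᶠ[𝓝 w] fun w => (cutoff n (w⁻¹).re : ℂ) * f (w⁻¹).re := by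
      filter_upwards [isOpen_ne.mem_nhds h0] with z hz
      exact if_neg hz
    refine ContinuousAt.continuousWithinAt (ContinuousAt.congr ?_ h1.symm)
    have h2 : ContinuousAt (fun w : ℂ => (w⁻¹).re) w :=
      Complex.continuous_re.continuousAt.comp (continuousAt_inv₀ h0)
    have := (continuous_cutoff n).continuousAt.comp h2
    exact (Complex.continuous_ofReal.continuousAt.comp this).mul (f.continuous.continuousAt.comp h2)

/-! ### Abstract resolvents -/

/-- A normal operator whose spectrum lies on `resolventCircle`. -/
structure IsResolventLike (R : H →L[ℂ] H) : Prop where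
  normal : IsStarNormal R
  spectrum_subset : spectrum ℂ R ⊆ resolventCircle

theorem resolventI_spec {A : H →ₗ.[ℂ] H} (hA : IsSelfAdjoint A) :
    IsResolvent A (resolventI A hA) := (existsUnique_isResolvent hA).choose_spec.1

/-- Comparing the two identities gives `R*R = RR*`. The calculus then turns the first one into a
function vanishing in `R`, hence vanishing on the spectrum. -/
theorem IsResolventLike.of_algebraic {R : H →L[ℂ] H}
    (h1 : R - star R + (2 * Complex.I) • (star R * R) = 0)
    (h2 : R - star R + (2 * Complex.I) • (R * star R) = 0) : IsResolventLike R := by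
  have hn : IsStarNormal R := ⟨by
    have h3 : (2 * Complex.I) • (star R * R) = (2 * Complex.I) • (R * star R) :=
      add_left_cancel (h1.trans h2.symm)
    exact smul_right_injective _ (by simp : 2 * Complex.I ≠ 0) h3⟩
  refine ⟨hn, ?_⟩
  have h3 : cfc (fun w : ℂ => w - star w + (2 * Complex.I) * (star w * w)) R =
      cfc (fun _ : ℂ => (0 : ℂ)) R := by
    rw [cfc_add (R := ℂ) (a := R) (fun w => w - star w) (fun w => (2 * Complex.I) * (star w * w)),
      cfc_sub (R := ℂ) (a := R) (fun w => w) (fun w => star w),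
      cfc_const_mul (R := ℂ) (2 * Complex.I) (fun w => star w * w) R,
      cfc_mul (R := ℂ) (a := R) (fun w => star w) (fun w => w),
      cfc_star (R := ℂ) (fun w => w) R, cfc_id' ℂ R, h1]
    simp
  have h4 := (cfc_eq_cfc_iff_eqOn (R := ℂ) (a := R)).mp h3
  exact fun w hw => h4 hw

/-- The identity with `R*R` follows from the symmetry of `A` alone. The one with `RR*` needs
self-adjointness, through the injectivity of `1 + 2i R*`, formally the Cayley transform `(A + i)(A -
i)⁻¹`. -/
theorem isResolventLike_resolventI {A : H →ₗ.[ℂ] H} (hA : IsSelfAdjoint A) :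
    IsResolventLike (resolventI A hA) := by
  set R := resolventI A hA with hR
  have hR' := resolventI_spec hA
  have h1 : R - star R + (2 * Complex.I) • (star R * R) = 0 := by
    ext y
    refine ext_inner_left ℂ fun z => ?_
    obtain ⟨x1, hx1, hz⟩ := hR' z
    obtain ⟨x2, hx2, hy⟩ := hR' y
    rw [← hR] at hx1 hx2
    have e1 : inner ℂ z (star R y) = inner ℂ (R z) y :=
      ContinuousLinearMap.adjoint_inner_right R z y
    have e2 : inner ℂ z ((star R * R) y) = inner ℂ (R z) (R y) :=
      ContinuousLinearMap.adjoint_inner_right R z (R y)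
    simp only [add_apply, sub_apply,
      smul_apply, inner_add_right, inner_sub_right, inner_smul_right, e1, e2,
      zero_apply, inner_zero_right]
    rw [← hx1, ← hx2]
    have e3 : inner ℂ z (x2 : H) = inner ℂ (A x1 + Complex.I • (x1 : H)) (x2 : H) := by rw [hz]
    have e4 : inner ℂ (x1 : H) y = inner ℂ (x1 : H) (A x2 + Complex.I • (x2 : H)) := by rw [hy]
    rw [e3, e4, inner_add_left, inner_add_right, inner_smul_left, inner_smul_right,
      symm_inner hA, Complex.conj_I]
    ring
  refine .of_algebraic h1 ?_
  -- Such a `y` satisfies `A* y = -i y`, so it lies in the kernel of `A + i`, which is trivial.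
  have hker : ∀ y : H, y + (2 * Complex.I) • star R y = 0 → y = 0 := by
    intro y hy
    have key : ∀ x : A.domain, inner ℂ (-Complex.I • y) (x : H) = inner ℂ y (A x) := by
      intro x
      obtain ⟨x', hx', hz⟩ := hR' (A x + Complex.I • (x : H))
      have hxx : x' = x := addI_injective hA hz
      rw [← hR] at hx'
      have h := congrArg (fun u => inner ℂ u (A x + Complex.I • (x : H))) hy
      have e1 : inner ℂ (star R y) (A x + Complex.I • (x : H)) = inner ℂ y (x : H) := by
        rw [hxx] at hx'
        conv_rhs => rw [hx']
        exact ContinuousLinearMap.adjoint_inner_left R _ _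
      simp only [inner_add_left, inner_smul_left, e1, inner_zero_left] at h
      rw [inner_add_right, inner_smul_right] at h
      rw [inner_smul_left]
      simp only [map_mul, map_ofNat, map_neg, Complex.conj_I] at h ⊢
      linear_combination -h
    have hmem : y ∈ A.adjoint.domain := LinearPMap.mem_adjoint_domain_of_exists y ⟨_, key⟩
    have happ : A.adjoint ⟨y, hmem⟩ = -Complex.I • y :=
      LinearPMap.adjoint_apply_eq hA.dense_domain _ key
    have hgr : (y, -Complex.I • y) ∈ A.graph := by
      have : (y, -Complex.I • y) ∈ A.adjoint.graph :=
        (LinearPMap.mem_graph_iff _).mpr ⟨⟨y, hmem⟩, rfl, happ⟩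
      rwa [LinearPMap.isSelfAdjoint_def.mp hA] at this
    obtain ⟨w, hw1, hw2⟩ := (LinearPMap.mem_graph_iff A).mp hgr
    simp only at hw1 hw2
    have : addI A w = addI A 0 := by
      rw [map_zero]; change A w + Complex.I • (w : H) = 0
      rw [hw2, hw1]; simp
    rw [← hw1, addI_injective hA this]; rfl
  ext y
  apply hker
  -- The injective factor `1 + 2i R*` intertwines the two identities, so the known one implies the
  -- other.
  have h3 : (1 + (2 * Complex.I) • star R) * (R - star R + (2 * Complex.I) • (R * star R)) =
      (R - star R + (2 * Complex.I) • (star R * R)) * (1 + (2 * Complex.I) • star R) := by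
    simp only [mul_add, add_mul, mul_sub, sub_mul, smul_mul_assoc, mul_smul_comm, one_mul, mul_one,
      smul_add, smul_sub, mul_assoc]
    abel
  rw [h1, zero_mul] at h3
  exact congrArg (fun T : H →L[ℂ] H => T y) h3

theorem isResolventLike_cfc {A : H →L[ℂ] H} (hA : IsSelfAdjoint A) :
    IsResolventLike (cfc (fun z : ℂ => (z.re + Complex.I)⁻¹) A) := by
  have hc : Continuous (fun z : ℂ => ((z.re : ℂ) + Complex.I)⁻¹) := by
    refine Continuous.inv₀ (by fun_prop) fun z h => ?_
    simpa using congrArg Complex.im h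
  have := hA.isStarNormal
  refine ⟨cfc_predicate _ _, ?_⟩
  rw [cfc_map_spectrum (R := ℂ) _ A hA.isStarNormal hc.continuousOn]
  rintro _ ⟨z, -, rfl⟩
  exact inv_add_I_mem_resolventCircle _

/-- `(φₙ f)(A)` as a function of the resolvent of `A`. -/
def truncRes (f : C(ℝ, ℂ)) (n : ℕ) (R : H →L[ℂ] H) : H →L[ℂ] H := cfc (truncFun f n) R

theorem truncRes_cfc (f : C(ℝ, ℂ)) (n : ℕ) {A : H →L[ℂ] H} (hA : IsSelfAdjoint A) :
    truncRes f n (cfc (fun z : ℂ => (z.re + Complex.I)⁻¹) A) =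
      cfc (fun z : ℂ => (cutoff n z.re : ℂ) * f z.re) A := by
  have hc : Continuous (fun z : ℂ => ((z.re : ℂ) + Complex.I)⁻¹) := by
    refine Continuous.inv₀ (by fun_prop) fun z h => ?_
    simpa using congrArg Complex.im h
  have := hA.isStarNormal
  rw [truncRes, ← cfc_comp (R := ℂ) (truncFun f n) _ A hA.isStarNormal
    ((continuousOn_truncFun f n).mono ?_) hc.continuousOn]
  · congr 1
    ext z
    exact truncFun_inv_add_I f n z.re
  · rintro _ ⟨z, -, rfl⟩
    exact inv_add_I_mem_resolventCircle _

theorem norm_truncRes_one_le (n : ℕ) (R : H →L[ℂ] H) : ‖truncRes 1 n R‖ ≤ 1 := by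
  refine norm_cfc_le zero_le_one fun w _ => ?_
  unfold truncFun
  split_ifs
  · simp
  · simpa [abs_of_nonneg (cutoff_nonneg _ _)] using cutoff_le_one _ _

/-! ### Cut-offs as substitutes for spectral projections -/

namespace IsResolventLike

variable {R : H →L[ℂ] H}

theorem continuousOn_truncFun (hR : IsResolventLike R) (f : C(ℝ, ℂ)) (n : ℕ) :
    ContinuousOn (truncFun f n) (spectrum ℂ R) :=
  (OperatorModulus.continuousOn_truncFun f n).mono hR.spectrum_subset

theorem norm_le_one (hR : IsResolventLike R) : ‖R‖ ≤ 1 := by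
  have := hR.normal
  rw [← cfc_id' ℂ R]
  exact norm_cfc_le zero_le_one fun w hw => norm_le_one_of_mem_resolventCircle (hR.spectrum_subset hw)

theorem truncRes_mul_one (hR : IsResolventLike R) {k m : ℕ} (h : k + 1 ≤ m) (f : C(ℝ, ℂ)) :
    truncRes f m R * truncRes 1 k R = truncRes f k R := by
  rw [truncRes, truncRes, ← cfc_mul (R := ℂ) _ _ R (hR.continuousOn_truncFun _ _)
    (hR.continuousOn_truncFun _ _)]
  rw [truncRes]
  congr 1
  ext w
  unfold truncFun
  split_ifs
  · simp
  · have := cutoff_mul_cutoff h (w⁻¹).re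
    rw [ContinuousMap.one_apply, mul_one, mul_right_comm, ← Complex.ofReal_mul, this]

/-- Since `0 ≤ φₙ ≤ 1`, the operator `S - S²` is `Q*Q` with `Q` given by the square root of `φₙ(1 -
φₙ)`. -/
theorem re_inner_truncRes_one (hR : IsResolventLike R) (n : ℕ) (x : H) :
    ‖truncRes 1 n R x‖ ^ 2 ≤ (inner ℂ (truncRes 1 n R x) x).re := by
  have hc := hR.continuousOn_truncFun 1 n
  have := hR.normal
  set S := truncRes 1 n R with hS
  have hre : ∀ w, truncFun 1 n w = ((truncFun 1 n w).re : ℂ) ∧ 0 ≤ (truncFun 1 n w).re ∧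
      (truncFun 1 n w).re ≤ 1 := by
    intro w
    unfold truncFun
    split_ifs
    · simp
    · simp [cutoff_nonneg, cutoff_le_one]
  have hstar : star S = S := by
    rw [hS, truncRes, ← cfc_star]
    congr 1
    ext w
    rw [(hre w).1]
    exact Complex.conj_ofReal _
  set Q := cfc (fun w => (Real.sqrt ((truncFun 1 n w).re * (1 - (truncFun 1 n w).re)) : ℂ)) R
    with hQ
  have hQc : ContinuousOn (fun w => (Real.sqrt ((truncFun 1 n w).re *
      (1 - (truncFun 1 n w).re)) : ℂ)) (spectrum ℂ R) := by
    have h1 := Complex.continuous_re.comp_continuousOn hc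
    exact Complex.continuous_ofReal.comp_continuousOn (h1.mul (continuousOn_const.sub h1)).sqrt
  have hQQ : star Q * Q = S - S * S := by
    rw [hQ, ← cfc_star, ← cfc_mul (R := ℂ) _ _ R hQc.star hQc, hS, truncRes,
      ← cfc_mul (R := ℂ) _ _ R hc hc, ← cfc_sub (R := ℂ) (a := R) (truncFun 1 n)
        (fun w => truncFun 1 n w * truncFun 1 n w) hc (hc.mul hc)]
    congr 1
    ext w
    obtain ⟨h1, h2, h3⟩ := hre w
    have h4 : 0 ≤ (truncFun 1 n w).re * (1 - (truncFun 1 n w).re) :=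
      mul_nonneg h2 (by linarith)
    rw [h1]
    simp only [Complex.star_def, Complex.conj_ofReal, Complex.ofReal_re]
    rw [← Complex.ofReal_mul, Real.mul_self_sqrt h4]
    push_cast
    ring
  have h1 : inner ℂ (Q x) (Q x) = inner ℂ ((star Q * Q) x) x :=
    (ContinuousLinearMap.adjoint_inner_left Q x (Q x)).symm
  have h2 : inner ℂ (S x) (S x) = inner ℂ ((S * S) x) x := by
    have := ContinuousLinearMap.adjoint_inner_left S x (S x)
    rw [← ContinuousLinearMap.star_eq_adjoint, hstar] at this
    exact this.symm
  rw [hQQ, sub_apply, inner_sub_left, ← h2] at h1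
  have h3 := congrArg Complex.re h1
  have h4 : (inner ℂ (Q x) (Q x)).re = ‖Q x‖ ^ 2 := inner_self_eq_norm_sq (𝕜 := ℂ) (Q x)
  have h5 : (inner ℂ (S x) (S x)).re = ‖S x‖ ^ 2 := inner_self_eq_norm_sq (𝕜 := ℂ) (S x)
  rw [Complex.sub_re, h4, h5] at h3
  nlinarith [sq_nonneg ‖Q x‖]

/-- A one-sided Pythagoras theorem: the cut-off is not a projection, but this inequality suffices to
deduce convergence from convergence of norms. -/
theorem norm_sub_truncRes_one_sq_le (hR : IsResolventLike R) (n : ℕ) (x : H) :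
    ‖x - truncRes 1 n R x‖ ^ 2 ≤ ‖x‖ ^ 2 - ‖truncRes 1 n R x‖ ^ 2 := by
  have h := hR.re_inner_truncRes_one n x
  have h2 := norm_sub_sq (𝕜 := ℂ) x (truncRes 1 n R x)
  have h3 : RCLike.re (inner ℂ x (truncRes 1 n R x)) = (inner ℂ (truncRes 1 n R x) x).re :=
    inner_re_symm (𝕜 := ℂ) _ _
  rw [h2, h3]
  linarith

/-- The function `(φₙ - 1)w` vanishes for `|t| ≤ n`, and beyond that `|w| = (t² + 1)^(-1/2)` is
small. -/
theorem norm_truncRes_one_mul_sub_le (hR : IsResolventLike R) (n : ℕ) :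
    ‖truncRes 1 n R * R - R‖ ≤ 1 / Real.sqrt ((n : ℝ) ^ 2 + 1) := by
  have hc := hR.continuousOn_truncFun 1 n
  have := hR.normal
  have h : truncRes 1 n R * R - R = cfc (fun w => truncFun 1 n w * w - w) R := by
    rw [cfc_sub (R := ℂ) (a := R) (fun w => truncFun 1 n w * w) (fun w => w)
      (hc.mul continuousOn_id), cfc_mul (R := ℂ) _ _ R hc, cfc_id' ℂ R, truncRes]
  rw [h]
  refine norm_cfc_le (by positivity) fun w hw => ?_
  by_cases h0 : w = 0
  · simp [h0]
  rw [truncFun, if_neg h0, ContinuousMap.one_apply, mul_one]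
  by_cases hn : |(w⁻¹).re| ≤ n
  · rw [cutoff_eq_one hn, Complex.ofReal_one, one_mul, sub_self, norm_zero]
    positivity
  have h1 := norm_le_of_cutoff_ne_one (hR.spectrum_subset hw) (not_le.mp hn).le
  have h2 : ‖w‖ ≤ 1 / Real.sqrt ((n : ℝ) ^ 2 + 1) := by
    rw [le_div_iff₀ (by positivity)]
    refine le_of_sq_le_sq ?_ zero_le_one
    rw [mul_pow, Real.sq_sqrt (by positivity), one_pow]
    exact h1
  refine le_trans ?_ h2
  have h3 : (cutoff n (w⁻¹).re : ℂ) * w - w = ((cutoff n (w⁻¹).re - 1 : ℝ) : ℂ) * w := by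
    push_cast; ring
  rw [h3, norm_mul, Complex.norm_real, Real.norm_eq_abs]
  refine mul_le_of_le_one_left (norm_nonneg _) (abs_le.mpr ⟨?_, ?_⟩)
  · linarith [cutoff_nonneg n (w⁻¹).re]
  · linarith [cutoff_le_one n (w⁻¹).re]

end IsResolventLike

end OperatorModulus
end

noncomputable section
namespace OperatorModulus

variable {H : Type u} [NormedAddCommGroup H] [InnerProductSpace ℂ H] [CompleteSpace H]
open Filter Topology

/-! ### Strong continuity of the continuous functional calculus -/

open Classical in
/-- Extension by zero of a continuous function on a subset of `ℂ`. -/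
def extendZero {S : Set ℂ} (g : C(S, ℂ)) (z : ℂ) : ℂ := if h : z ∈ S then g ⟨z, h⟩ else 0

theorem extendZero_of_mem {S : Set ℂ} (g : C(S, ℂ)) {z : ℂ} (hz : z ∈ S) :
    extendZero g z = g ⟨z, hz⟩ := dif_pos hz

theorem continuousOn_extendZero {S : Set ℂ} (g : C(S, ℂ)) : ContinuousOn (extendZero g) S := by
  rw [continuousOn_iff_continuous_domRestrict]
  refine g.continuous.congr fun z => ?_
  exact (extendZero_of_mem g z.2).symm

/-- If `R i ∘ V → V ∘ R₀` and `(R i)* ∘ V → V ∘ R₀*` strongly, for normal operators with spectra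
in a common compact set, then also `g(R i) ∘ V → V ∘ g(R₀)` strongly. -/
theorem tendsto_cfc_apply {G : Type u} [NormedAddCommGroup G] [InnerProductSpace ℂ G]
    [CompleteSpace G] {ι : Type*} {l : Filter ι} {S : Set ℂ} (hS : IsCompact S)
    {R : ι → G →L[ℂ] G} {R₀ : H →L[ℂ] H} (V : H →L[ℂ] G)
    (hn : ∀ i, IsStarNormal (R i)) (hn₀ : IsStarNormal R₀)
    (hs : ∀ i, spectrum ℂ (R i) ⊆ S) (hs₀ : spectrum ℂ R₀ ⊆ S)
    (h : ∀ x, Tendsto (fun i => R i (V x)) l (𝓝 (V (R₀ x))))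
    (hstar : ∀ x, Tendsto (fun i => star (R i) (V x)) l (𝓝 (V (star R₀ x))))
    {φ : ℂ → ℂ} (hφ : ContinuousOn φ S) (x : H) :
    Tendsto (fun i => cfc φ (R i) (V x)) l (𝓝 (V (cfc φ R₀ x))) := by
  have : CompactSpace S := isCompact_iff_compactSpace.mp hS
  have key : ∀ (g : C(S, ℂ)), ∀ x,
      Tendsto (fun i => cfc (extendZero g) (R i) (V x)) l (𝓝 (V (cfc (extendZero g) R₀ x))) := by
    have hbound : ∀ (K : Type u) [NormedAddCommGroup K] [InnerProductSpace ℂ K] [CompleteSpace K]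
        (T : K →L[ℂ] K), spectrum ℂ T ⊆ S → ∀ g : C(S, ℂ), ‖cfc (extendZero g) T‖ ≤ ‖g‖ := by
      intro K _ _ _ T hT g
      refine norm_cfc_le (norm_nonneg _) fun z hz => ?_
      rw [extendZero_of_mem g (hT hz)]
      exact g.norm_coe_le_norm _
    intro g
    -- Stone–Weierstrass: the functions with the convergence property contain the constants, `z` and
    -- `z̄`, and are closed under sums, products and uniform limits.
    induction g using ContinuousMap.induction_on_of_compact with
    | const r =>
      intro x
      have e : ∀ (K : Type u) [NormedAddCommGroup K] [InnerProductSpace ℂ K] [CompleteSpace K]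
          (T : K →L[ℂ] K), IsStarNormal T → spectrum ℂ T ⊆ S →
          cfc (extendZero (ContinuousMap.const S r)) T = r • 1 := by
        intro K _ _ _ T hT hTS
        rw [cfc_congr (g := fun _ => r) fun z hz => extendZero_of_mem _ (hTS hz), cfc_const r T]
        exact Algebra.algebraMap_eq_smul_one r
      simp only [e G _ (hn _) (hs _), e H _ hn₀ hs₀]
      simpa using tendsto_const_nhds
    | id =>
      intro x
      have e : ∀ (K : Type u) [NormedAddCommGroup K] [InnerProductSpace ℂ K] [CompleteSpace K]
          (T : K →L[ℂ] K), IsStarNormal T → spectrum ℂ T ⊆ S →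
          cfc (extendZero (.restrict S <| .id ℂ)) T = T := by
        intro K _ _ _ T hT hTS
        rw [cfc_congr (g := fun z => z) fun z hz => extendZero_of_mem _ (hTS hz), cfc_id' ℂ T]
      simp only [e G _ (hn _) (hs _), e H _ hn₀ hs₀]
      exact h x
    | star_id =>
      intro x
      have e : ∀ (K : Type u) [NormedAddCommGroup K] [InnerProductSpace ℂ K] [CompleteSpace K]
          (T : K →L[ℂ] K), IsStarNormal T → spectrum ℂ T ⊆ S →
          cfc (extendZero (star (.restrict S <| .id ℂ))) T = star T := by
        intro K _ _ _ T hT hTS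
        rw [cfc_congr (g := fun z => star z) fun z hz => extendZero_of_mem _ (hTS hz),
          cfc_star (fun z => z) T, cfc_id' ℂ T]
      simp only [e G _ (hn _) (hs _), e H _ hn₀ hs₀]
      exact hstar x
    | add f g hf hg =>
      intro x
      have e : ∀ (K : Type u) [NormedAddCommGroup K] [InnerProductSpace ℂ K] [CompleteSpace K]
          (T : K →L[ℂ] K), spectrum ℂ T ⊆ S →
          cfc (extendZero (f + g)) T = cfc (extendZero f) T + cfc (extendZero g) T := by
        intro K _ _ _ T hTS
        rw [← cfc_add (R := ℂ) (a := T) _ _ ((continuousOn_extendZero f).mono hTS)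
          ((continuousOn_extendZero g).mono hTS)]
        refine cfc_congr fun z hz => ?_
        simp [extendZero_of_mem _ (hTS hz)]
      simp only [e G _ (hs _), e H _ hs₀, add_apply, map_add]
      exact (hf x).add (hg x)
    | mul f g hf hg =>
      intro x
      have e : ∀ (K : Type u) [NormedAddCommGroup K] [InnerProductSpace ℂ K] [CompleteSpace K]
          (T : K →L[ℂ] K), spectrum ℂ T ⊆ S →
          cfc (extendZero (f * g)) T = cfc (extendZero f) T * cfc (extendZero g) T := by
        intro K _ _ _ T hTS
        rw [← cfc_mul (R := ℂ) _ _ T ((continuousOn_extendZero f).mono hTS)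
          ((continuousOn_extendZero g).mono hTS)]
        refine cfc_congr fun z hz => ?_
        simp [extendZero_of_mem _ (hTS hz)]
      simp only [e G _ (hs _), e H _ hs₀, mul_apply_eq_comp]
      -- Strong limits multiply because the left factors are bounded by `‖f‖` uniformly in `i`.
      have h1 : Tendsto (fun i => cfc (extendZero f) (R i)
          (cfc (extendZero g) (R i) (V x) - V (cfc (extendZero g) R₀ x))) l (𝓝 0) := by
        have h2 := ((hg x).sub_const (V (cfc (extendZero g) R₀ x))).norm.const_mul ‖f‖
        rw [sub_self, norm_zero, mul_zero] at h2
        exact squeeze_zero_norm (fun i => ContinuousLinearMap.le_of_opNorm_le _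
          (hbound G _ (hs i) f) _) h2
      have h3 := h1.add (hf (cfc (extendZero g) R₀ x))
      simpa using h3
    | frequently f hf =>
      intro x
      rw [Metric.tendsto_nhds]
      intro ε hε
      set C := ‖V‖ * ‖x‖ + 1 with hC
      have hC0 : 0 < C := by positivity
      obtain ⟨g, hg, hgp⟩ := (hf.and_eventually
        (Metric.ball_mem_nhds f (show 0 < ε / (3 * C) by positivity))).exists
      have hfg : ‖f - g‖ ≤ ε / (3 * C) := by
        rw [← dist_eq_norm, dist_comm]; exact (Metric.mem_ball.mp hgp).le
      have hdiff : ∀ (K : Type u) [NormedAddCommGroup K] [InnerProductSpace ℂ K] [CompleteSpace K]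
          (T : K →L[ℂ] K), spectrum ℂ T ⊆ S → ∀ y,
          ‖cfc (extendZero f) T y - cfc (extendZero g) T y‖ ≤ ε / (3 * C) * ‖y‖ := by
        intro K _ _ _ T hTS y
        rw [← sub_apply, ← cfc_sub (R := ℂ) (a := T) _ _ ((continuousOn_extendZero f).mono hTS)
          ((continuousOn_extendZero g).mono hTS)]
        refine ContinuousLinearMap.le_of_opNorm_le _ ?_ y
        refine norm_cfc_le (by positivity) fun z hz => ?_
        rw [extendZero_of_mem _ (hTS hz), extendZero_of_mem _ (hTS hz)]
        exact ((f - g).norm_coe_le_norm ⟨z, hTS hz⟩).trans hfg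
      filter_upwards [Metric.tendsto_nhds.mp (hg x) (ε / 3) (by positivity)] with i hi
      rw [dist_eq_norm] at hi ⊢
      have h1 := hdiff G _ (hs i) (V x)
      have h2 : ‖V (cfc (extendZero f) R₀ x) - V (cfc (extendZero g) R₀ x)‖ ≤
          ‖V‖ * (ε / (3 * C) * ‖x‖) := by
        rw [← map_sub]
        exact (V.le_opNorm _).trans (by gcongr; exact hdiff H _ hs₀ x)
      have h3 : ε / (3 * C) * (‖V‖ * ‖x‖) ≤ ε / 3 := by
        rw [div_mul_eq_mul_div, div_le_div_iff₀ (by positivity) (by positivity)]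
        nlinarith
      have h4 : ε / (3 * C) * ‖V x‖ ≤ ε / 3 :=
        (mul_le_mul_of_nonneg_left (V.le_opNorm x) (by positivity)).trans h3
      calc _ = ‖(cfc (extendZero f) (R i) (V x) - cfc (extendZero g) (R i) (V x)) +
            (cfc (extendZero g) (R i) (V x) - V (cfc (extendZero g) R₀ x)) -
            (V (cfc (extendZero f) R₀ x) - V (cfc (extendZero g) R₀ x))‖ := by congr 1; abel
        _ ≤ ‖cfc (extendZero f) (R i) (V x) - cfc (extendZero g) (R i) (V x)‖ +
            ‖cfc (extendZero g) (R i) (V x) - V (cfc (extendZero g) R₀ x)‖ +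
            ‖V (cfc (extendZero f) R₀ x) - V (cfc (extendZero g) R₀ x)‖ :=
          (norm_sub_le _ _).trans (by gcongr; exact norm_add_le _ _)
        _ < ε := by nlinarith
  have hφ' : Continuous (S.domRestrict φ) := continuousOn_iff_continuous_domRestrict.mp hφ
  have e : ∀ (K : Type u) [NormedAddCommGroup K] [InnerProductSpace ℂ K] [CompleteSpace K]
      (T : K →L[ℂ] K), spectrum ℂ T ⊆ S → cfc (extendZero ⟨S.domRestrict φ, hφ'⟩) T = cfc φ T := by
    intro K _ _ _ T hTS
    exact cfc_congr fun z hz => extendZero_of_mem _ (hTS hz)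
  have := key ⟨S.domRestrict φ, hφ'⟩ x
  simpa only [e G _ (hs _), e H _ hs₀] using this

/-- Strong convergence of normal operators to a normal operator implies that of their adjoints. -/
theorem tendsto_star_apply {ι : Type*} {l : Filter ι} {R : ι → H →L[ℂ] H} {R₀ : H →L[ℂ] H}
    (hn : ∀ i, IsStarNormal (R i)) (hn₀ : IsStarNormal R₀)
    (h : ∀ x, Tendsto (fun i => R i x) l (𝓝 (R₀ x))) (x : H) :
    Tendsto (fun i => star (R i) x) l (𝓝 (star R₀ x)) := by
  have hnorm : ∀ T : H →L[ℂ] H, IsStarNormal T → ‖star T x‖ = ‖T x‖ := fun T hT =>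
    (ContinuousLinearMap.isStarNormal_iff_norm_eq_adjoint.mp hT x).symm
  rw [tendsto_iff_norm_sub_tendsto_zero]
  -- Normality replaces `‖Rᵢ* x‖` by `‖Rᵢ x‖`, after which only strong limits of the `Rᵢ` themselves
  -- occur.
  have e : ∀ i, ‖star (R i) x - star R₀ x‖ ^ 2 =
      ‖R i x‖ ^ 2 - 2 * (inner ℂ x (R i (star R₀ x))).re + ‖star R₀ x‖ ^ 2 := by
    intro i
    rw [norm_sub_sq (𝕜 := ℂ), hnorm _ (hn i)]
    congr 3
    exact congrArg Complex.re (ContinuousLinearMap.adjoint_inner_left (R i) (star R₀ x) x)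
  have h1 : Tendsto (fun i => ‖star (R i) x - star R₀ x‖ ^ 2) l (𝓝 0) := by
    simp only [e]
    have h2 := ((h x).norm.pow 2).sub ((Complex.continuous_re.continuousAt.tendsto.comp
      ((tendsto_const_nhds (x := x)).inner (h (star R₀ x)) (𝕜 := ℂ))).const_mul 2)
    have h3 := h2.add_const (‖star R₀ x‖ ^ 2)
    have h4 : inner ℂ x (R₀ (star R₀ x)) = inner ℂ (star R₀ x) (star R₀ x) :=
      (ContinuousLinearMap.adjoint_inner_left R₀ (star R₀ x) x).symm
    have h5 : (inner ℂ (star R₀ x) (star R₀ x)).re = ‖star R₀ x‖ ^ 2 :=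
      inner_self_eq_norm_sq (𝕜 := ℂ) _
    have h7 : ‖R₀ x‖ ^ 2 - 2 * (inner ℂ x (R₀ (star R₀ x))).re + ‖star R₀ x‖ ^ 2 = 0 := by
      rw [h4, h5, hnorm _ hn₀]; ring
    rw [h7] at h3
    exact h3
  have h6 := h1.sqrt
  simpa [Real.sqrt_sq] using h6

theorem tendsto_truncRes_apply {ι : Type*} {l : Filter ι} {R : ι → H →L[ℂ] H} {R₀ : H →L[ℂ] H}
    (hR : ∀ i, IsResolventLike (R i)) (hR₀ : IsResolventLike R₀)
    (h : ∀ x, Tendsto (fun i => R i x) l (𝓝 (R₀ x))) (f : C(ℝ, ℂ)) (n : ℕ) (x : H) :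
    Tendsto (fun i => truncRes f n (R i) x) l (𝓝 (truncRes f n R₀ x)) :=
  tendsto_cfc_apply isCompact_resolventCircle (ContinuousLinearMap.id ℂ H)
    (fun i => (hR i).normal) hR₀.normal (fun i => (hR i).spectrum_subset) hR₀.spectrum_subset h
    (tendsto_star_apply (fun i => (hR i).normal) hR₀.normal h) (continuousOn_truncFun f n) x

/-- For a constant family over a one-point index set, the convergence theorem says exactly that
intertwining passes to functions of the operators. -/
theorem truncRes_comp {G : Type u} [NormedAddCommGroup G] [InnerProductSpace ℂ G]
    [CompleteSpace G] {R : G →L[ℂ] G} {R₀ : H →L[ℂ] H} (hR : IsResolventLike R)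
    (hR₀ : IsResolventLike R₀) (V : H →L[ℂ] G) (h : ∀ x, R (V x) = V (R₀ x))
    (hstar : ∀ x, star R (V x) = V (star R₀ x)) (f : C(ℝ, ℂ)) (n : ℕ) (x : H) :
    truncRes f n R (V x) = V (truncRes f n R₀ x) := by
  have := tendsto_cfc_apply (ι := Unit) (l := ⊤) isCompact_resolventCircle (R := fun _ => R) V
    (fun _ => hR.normal) hR₀.normal (fun _ => hR.spectrum_subset) hR₀.spectrum_subset
    (fun x => by simp [h]) (fun x => by simp [hstar]) (continuousOn_truncFun f n) x
  exact tendsto_nhds_unique tendsto_const_nhds this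

end OperatorModulus
end

noncomputable section
namespace OperatorModulus

variable {H : Type u} [NormedAddCommGroup H] [InnerProductSpace ℂ H] [CompleteSpace H]
open Filter Topology

/-! ### Perturbations of unbounded self-adjoint operators -/

theorem resolventI_apply_add_I {A : H →ₗ.[ℂ] H} (hA : IsSelfAdjoint A) (x : A.domain) :
    resolventI A hA (A x + Complex.I • (x : H)) = x := by
  obtain ⟨x', hx', h⟩ := resolventI_spec hA (A x + Complex.I • (x : H))
  rw [← hx', addI_injective hA (show addI A x' = addI A x from h)]

theorem denseRange_resolventI {A : H →ₗ.[ℂ] H} (hA : IsSelfAdjoint A) :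
    DenseRange (resolventI A hA) :=
  hA.dense_domain.mono fun x hx => ⟨_, resolventI_apply_add_I hA ⟨x, hx⟩⟩

/-- On the range of `R` the preceding norm estimate applies; the uniform bound `‖φₙ‖ ≤ 1` extends
the convergence to the closure. -/
theorem IsResolventLike.tendsto_truncRes_one {R : H →L[ℂ] H} (hR : IsResolventLike R)
    (hd : DenseRange R) (x : H) : Tendsto (fun n => truncRes 1 n R x) atTop (𝓝 x) := by
  rw [Metric.tendsto_atTop]
  intro ε hε
  obtain ⟨y, hy⟩ := hd.exists_dist_lt x (show 0 < ε / 3 by positivity)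
  have h0 : Tendsto (fun n : ℕ => 1 / Real.sqrt ((n : ℝ) ^ 2 + 1) * ‖y‖) atTop (𝓝 0) := by
    have h1 : Tendsto (fun n : ℕ => Real.sqrt ((n : ℝ) ^ 2 + 1)) atTop atTop := by
      refine tendsto_atTop_mono (fun n => ?_) tendsto_natCast_atTop_atTop
      exact Real.le_sqrt_of_sq_le (by linarith)
    simpa using (h1.inv_tendsto_atTop).mul_const ‖y‖
  obtain ⟨N, hN⟩ := Metric.tendsto_atTop.mp h0 (ε / 3) (by positivity)
  refine ⟨N, fun n hn => ?_⟩
  have h1 : ‖truncRes 1 n R (R y) - R y‖ ≤ 1 / Real.sqrt ((n : ℝ) ^ 2 + 1) * ‖y‖ :=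
    ContinuousLinearMap.le_of_opNorm_le _ (hR.norm_truncRes_one_mul_sub_le n) y
  have h2 := hN n hn
  rw [Real.dist_eq, sub_zero, abs_of_nonneg (by positivity)] at h2
  have h3 : ‖truncRes 1 n R (x - R y)‖ ≤ ‖x - R y‖ := by
    simpa using ContinuousLinearMap.le_of_opNorm_le _ (norm_truncRes_one_le n R) (x - R y)
  rw [dist_eq_norm] at hy ⊢
  have h4 : truncRes 1 n R x - x =
      truncRes 1 n R (x - R y) + (truncRes 1 n R (R y) - R y) - (x - R y) := by
    rw [map_sub]; abel
  rw [h4]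
  calc _ ≤ ‖truncRes 1 n R (x - R y)‖ + ‖truncRes 1 n R (R y) - R y‖ + ‖x - R y‖ :=
        (norm_sub_le _ _).trans (by gcongr; exact norm_add_le _ _)
    _ < ε := by linarith

/-- The identity of `ℝ` as a complex-valued continuous function. -/
def coeMap : C(ℝ, ℂ) := ⟨fun t => (t : ℂ), Complex.continuous_ofReal⟩

theorem isSelfAdjoint_truncRes_coeMap (n : ℕ) (R : H →L[ℂ] H) :
    IsSelfAdjoint (truncRes coeMap n R) := by
  rw [IsSelfAdjoint, truncRes, ← cfc_star]
  congr 1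
  ext w
  unfold truncFun
  split_ifs
  · simp
  · simp [coeMap]

/-- From `w⁻¹ = t + i` one has `t w = 1 - i w`. -/
theorem IsResolventLike.truncRes_coeMap_mul {R : H →L[ℂ] H} (hR : IsResolventLike R) (n : ℕ) :
    truncRes coeMap n R * R = truncRes 1 n R * (1 - Complex.I • R) := by
  have := hR.normal
  have h1 : (1 : H →L[ℂ] H) - Complex.I • R = cfc (fun w => 1 - Complex.I * w) R := by
    rw [cfc_sub (R := ℂ) (a := R) (fun _ => 1) (fun w => Complex.I * w), cfc_const_one ℂ R,
      cfc_const_mul (R := ℂ) Complex.I (fun w => w) R, cfc_id' ℂ R]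
  have h2 : truncRes coeMap n R * R = cfc (fun w => truncFun coeMap n w * w) R := by
    rw [cfc_mul (R := ℂ) _ _ R (hR.continuousOn_truncFun _ _), cfc_id' ℂ R, truncRes]
  rw [h1, h2, truncRes, ← cfc_mul (R := ℂ) _ _ R (hR.continuousOn_truncFun _ _)]
  refine cfc_congr fun w hw => ?_
  by_cases h0 : w = 0
  · simp [h0, truncFun_zero]
  simp only [truncFun, if_neg h0, ContinuousMap.one_apply, mul_one]
  have h3 := exists_eq_inv_add_I (hR.spectrum_subset hw) h0
  have h4 : w⁻¹ = ((w⁻¹).re : ℂ) + Complex.I := by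
    conv_lhs => rw [h3, inv_inv]
  have h5 : ((w⁻¹).re : ℂ) * w = 1 - Complex.I * w := by
    rw [eq_comm, ← eq_sub_iff_add_eq] at h4
    rw [h4, sub_mul, inv_mul_cancel₀ h0]
  rw [mul_assoc, ← h5]
  rfl

/-- Writing `x = R(Ax + ix)` gives `(φₙ t)(A) x = φₙ(A) Ax`. These bounded self-adjoint operators
are the approximants of `A`. -/
theorem tendsto_truncRes_coeMap {A : H →ₗ.[ℂ] H} (hA : IsSelfAdjoint A) (x : A.domain) :
    Tendsto (fun n => truncRes coeMap n (resolventI A hA) x) atTop (𝓝 (A x)) := by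
  have hR := isResolventLike_resolventI hA
  have h := hR.tendsto_truncRes_one (denseRange_resolventI hA) (A x)
  refine h.congr fun n => ?_
  have h1 := congrArg (fun T : H →L[ℂ] H => T (A x + Complex.I • (x : H)))
    (hR.truncRes_coeMap_mul n)
  simp only [mul_apply_eq_comp, resolventI_apply_add_I hA, sub_apply, smul_apply,
    one_apply_eq_self, add_sub_cancel_right] at h1
  exact h1.symm

theorem cfc_inv_add_I_mul {A : H →L[ℂ] H} (hA : IsSelfAdjoint A) :
    cfc (fun z : ℂ => (z.re + Complex.I)⁻¹) A * (A + Complex.I • 1) = 1 := by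
  have hne : ∀ z : ℂ, (z.re : ℂ) + Complex.I ≠ 0 := fun z h => by
    simpa using congrArg Complex.im h
  have hc : Continuous (fun z : ℂ => ((z.re : ℂ) + Complex.I)⁻¹) :=
    Continuous.inv₀ (by fun_prop) hne
  have := hA.isStarNormal
  have h1 : A + Complex.I • 1 = cfc (fun z : ℂ => z + Complex.I) A := by
    rw [cfc_add (R := ℂ) (a := A) (fun z => z) (fun _ => Complex.I), cfc_id' ℂ A,
      cfc_const Complex.I A, Algebra.algebraMap_eq_smul_one]
  rw [h1, ← cfc_mul (R := ℂ) _ _ A hc.continuousOn, ← cfc_const_one ℂ A]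
  refine cfc_congr fun z hz => ?_
  have hz' := hA.mem_spectrum_eq_re hz
  change ((z.re : ℂ) + Complex.I)⁻¹ * (z + Complex.I) = 1
  conv_lhs => rw [hz']
  simp [hne z]

/-- Strong convergence on the domain implies strong resolvent convergence. -/
theorem tendsto_cfc_inv_add_I {A : H →ₗ.[ℂ] H} (hA : IsSelfAdjoint A) {ι : Type*} {l : Filter ι}
    {S : ι → H →L[ℂ] H} (hS : ∀ i, IsSelfAdjoint (S i))
    (h : ∀ x : A.domain, Tendsto (fun i => S i x) l (𝓝 (A x))) (y : H) :
    Tendsto (fun i => cfc (fun z : ℂ => (z.re + Complex.I)⁻¹) (S i) y) l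
      (𝓝 (resolventI A hA y)) := by
  obtain ⟨x, hx, hy⟩ := resolventI_spec hA y
  rw [← hx, tendsto_iff_norm_sub_tendsto_zero]
  have h1 := (tendsto_iff_norm_sub_tendsto_zero.mp (h x))
  refine squeeze_zero (fun _ => norm_nonneg _) (fun i => ?_) h1
  have h2 := congrArg (fun T : H →L[ℂ] H => T (x : H)) (cfc_inv_add_I_mul (hS i))
  simp only [mul_apply_eq_comp, add_apply, smul_apply, one_apply_eq_self] at h2
  -- With `y = (A + i)x` and `x = (Sᵢ + i)⁻¹(Sᵢ + i)x`, the difference is the contraction `(Sᵢ +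
  -- i)⁻¹` applied to `Ax - Sᵢx`.
  have h3 : cfc (fun z : ℂ => (z.re + Complex.I)⁻¹) (S i) y - x =
      cfc (fun z : ℂ => (z.re + Complex.I)⁻¹) (S i) (A x - S i x) := by
    conv_lhs => rhs; rw [← h2]
    rw [← hy, ← map_sub, add_sub_add_right_eq_sub]
  rw [h3, norm_sub_rev (S i x)]
  exact (ContinuousLinearMap.le_of_opNorm_le _ (isResolventLike_cfc (hS i)).norm_le_one _).trans_eq
    (one_mul _)

theorem isSelfAdjoint_of_eq_vadd {A B : H →ₗ.[ℂ] H} (hA : IsSelfAdjoint A) (hB : IsSelfAdjoint B)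
    {K : H →L[ℂ] H} (h : A = (K : H →ₗ[ℂ] H) +ᵥ B) : IsSelfAdjoint K := by
  rw [ContinuousLinearMap.isSelfAdjoint_iff_isSymmetric]
  subst h
  have h1 : ∀ x y : B.domain, inner ℂ (K x) (y : H) = inner ℂ (x : H) (K y) := by
    intro x y
    have h2 := symm_inner hA x y
    have h3 := symm_inner hB x y
    simp only [LinearPMap.vadd_apply, inner_add_left, inner_add_right] at h2
    change inner ℂ (K x) (y : H) + inner ℂ (B x) (y : H) =
      inner ℂ (x : H) (K y) + inner ℂ (x : H) (B y) at h2
    rw [h3] at h2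
    exact add_right_cancel h2
  intro x y
  have hd := hB.dense_domain
  refine hd.induction (P := fun x => inner ℂ (K x) y = inner ℂ x (K y)) (fun x hx => ?_)
    (isClosed_eq (by fun_prop) (by fun_prop)) x
  refine hd.induction (P := fun y => inner ℂ (K x) y = inner ℂ x (K y)) (fun y hy => ?_)
    (isClosed_eq (by fun_prop) (by fun_prop)) y
  exact h1 ⟨x, hx⟩ ⟨y, hy⟩

theorem continuous_cutoff_mul (f : C(ℝ, ℂ)) (n : ℕ) :
    Continuous fun z : ℂ => (cutoff n z.re : ℂ) * f z.re := by
  have := continuous_cutoff n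
  fun_prop

theorem exists_norm_truncRes_le (f : C(ℝ, ℂ)) (n : ℕ) :
    ∃ C : ℝ, ∀ R : H →L[ℂ] H, IsResolventLike R → ‖truncRes f n R‖ ≤ C := by
  obtain ⟨C, hC⟩ := isCompact_resolventCircle.exists_bound_of_continuousOn
    (continuousOn_truncFun f n)
  have hC0 : 0 ≤ C := (norm_nonneg _).trans (hC 0 (by simp [mem_resolventCircle_iff]))
  exact ⟨C, fun R hR => norm_cfc_le hC0 fun w hw => hC w (hR.spectrum_subset hw)⟩

/-- Formally the operator is `φₘ(A)(f(A) - f(B))φₖ(B)`, written without `f(A)` and `f(B)` so that it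
makes sense before the domains have been compared. -/
theorem norm_truncRes_commutator_le (f : C(ℝ, ℂ)) {A B : H →ₗ.[ℂ] H} (hA : IsSelfAdjoint A)
    (hB : IsSelfAdjoint B) {K : H →L[ℂ] H} (h : A = (K : H →ₗ[ℂ] H) +ᵥ B) {ω : ℝ}
    (hω : ∀ S T : H →L[ℂ] H, IsSelfAdjoint S → IsSelfAdjoint T → S - T = K →
      ‖fcBounded f S - fcBounded f T‖ ≤ ω) (m k : ℕ) :
    ‖truncRes f m (resolventI A hA) * truncRes 1 k (resolventI B hB) -
      truncRes 1 m (resolventI A hA) * truncRes f k (resolventI B hB)‖ ≤ ω := by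
  have hK := isSelfAdjoint_of_eq_vadd hA hB h
  -- Only `B` is truncated. Adding the full `K` keeps the difference of the approximants exactly
  -- `K`, while `K + Tₙ` still converges to `A` on its domain.
  set T : ℕ → H →L[ℂ] H := fun n => truncRes coeMap n (resolventI B hB) with hTdef
  have hT : ∀ n, IsSelfAdjoint (T n) := fun n => isSelfAdjoint_truncRes_coeMap n _
  have hS : ∀ n, IsSelfAdjoint (K + T n) := fun n => hK.add (hT n)
  have hTB := tendsto_cfc_inv_add_I hB hT (tendsto_truncRes_coeMap hB)
  have hSA := tendsto_cfc_inv_add_I hA hS (fun x => by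
    subst h
    exact tendsto_const_nhds.add (tendsto_truncRes_coeMap hB x))
  set RT : ℕ → H →L[ℂ] H := fun n => cfc (fun z : ℂ => (z.re + Complex.I)⁻¹) (T n)
  set RS : ℕ → H →L[ℂ] H := fun n => cfc (fun z : ℂ => (z.re + Complex.I)⁻¹) (K + T n)
  have hRT : ∀ n, IsResolventLike (RT n) := fun n => isResolventLike_cfc (hT n)
  have hRS : ∀ n, IsResolventLike (RS n) := fun n => isResolventLike_cfc (hS n)
  have hω0 : 0 ≤ ω := (norm_nonneg _).trans (hω _ _ (hS 0) (hT 0) (add_sub_cancel_right _ _))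
  have hprod : ∀ (g₁ g₂ : C(ℝ, ℂ)) (x : H), Tendsto
      (fun n => truncRes g₁ m (RS n) (truncRes g₂ k (RT n) x)) atTop
      (𝓝 (truncRes g₁ m (resolventI A hA) (truncRes g₂ k (resolventI B hB) x))) := by
    intro g₁ g₂ x
    obtain ⟨C, hC⟩ := exists_norm_truncRes_le (H := H) g₁ m
    have h1 := tendsto_truncRes_apply hRT (isResolventLike_resolventI hB) hTB g₂ k x
    have h2 := tendsto_truncRes_apply hRS (isResolventLike_resolventI hA) hSA g₁ m
      (truncRes g₂ k (resolventI B hB) x)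
    have h3 := (tendsto_iff_norm_sub_tendsto_zero.mp h1).const_mul C
    rw [mul_zero] at h3
    have h4 := (squeeze_zero_norm (fun n => ContinuousLinearMap.le_of_opNorm_le _
      (hC _ (hRS n)) _) h3).add h2
    simpa using h4
  refine ContinuousLinearMap.opNorm_le_bound _ hω0 fun x => ?_
  refine le_of_tendsto ((hprod f 1 x).sub (hprod 1 f x)).norm (Eventually.of_forall fun n => ?_)
  -- For bounded operators `φₘ f` factors as `φₘ` times `f`, which puts `f(Sₙ) - f(Tₙ)` between two
  -- contractions.
  have e : truncRes f m (RS n) * truncRes 1 k (RT n) - truncRes 1 m (RS n) * truncRes f k (RT n) =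
      truncRes 1 m (RS n) * (fcBounded f (K + T n) - fcBounded f (T n)) * truncRes 1 k (RT n) := by
    have hfc : Continuous fun z : ℂ => f z.re := by fun_prop
    have e1 : truncRes f m (RS n) = truncRes 1 m (RS n) * fcBounded f (K + T n) := by
      rw [truncRes_cfc f m (hS n), truncRes_cfc 1 m (hS n), fcBounded, ← cfc_mul (R := ℂ) _ _ _
        (continuous_cutoff_mul 1 m).continuousOn hfc.continuousOn]
      simp
    have e2 : truncRes f k (RT n) = fcBounded f (T n) * truncRes 1 k (RT n) := by
      rw [truncRes_cfc f k (hT n), truncRes_cfc 1 k (hT n), fcBounded, ← cfc_mul (R := ℂ) _ _ _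
        hfc.continuousOn (continuous_cutoff_mul 1 k).continuousOn]
      simp [mul_comm]
    rw [e1, e2, mul_sub, sub_mul, mul_assoc, mul_assoc]
  have e' := congrArg (fun S : H →L[ℂ] H => S x) e
  simp only [sub_apply, mul_apply_eq_comp] at e'
  rw [e', ← sub_apply]
  have b1 := ContinuousLinearMap.le_of_opNorm_le _ (norm_truncRes_one_le k (RT n)) x
  have b2 := ContinuousLinearMap.le_of_opNorm_le _
    (hω _ _ (hS n) (hT n) (add_sub_cancel_right _ _)) (truncRes 1 k (RT n) x)
  have b3 := ContinuousLinearMap.le_of_opNorm_le _ (norm_truncRes_one_le m (RS n))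
    ((fcBounded f (K + T n) - fcBounded f (T n)) (truncRes 1 k (RT n) x))
  rw [one_mul] at b1 b3
  exact b3.trans (b2.trans (by gcongr))

/-- The limiting argument which recovers `f(A)` from its truncations. -/
theorem exists_tendsto_truncRes (f : C(ℝ, ℂ)) {R Q : H →L[ℂ] H} (hR : IsResolventLike R)
    (hRd : DenseRange R) (hQ : IsResolventLike Q) (hQd : DenseRange Q) {ω : ℝ}
    (h : ∀ m k, ‖truncRes f m R * truncRes 1 k Q - truncRes 1 m R * truncRes f k Q‖ ≤ ω)
    {u w : H} (hw : Tendsto (fun k => truncRes f k Q u) atTop (𝓝 w)) :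
    ∃ v, Tendsto (fun m => truncRes f m R u) atTop (𝓝 (v + w)) ∧ ‖v‖ ≤ ω * ‖u‖ := by
  -- Formally `T m = φₘ(A)(f(A) - f(B))u`. Letting `k → ∞` in the hypothesis bounds it by `ω‖u‖` for
  -- every `m`.
  set T : ℕ → H := fun m => truncRes f m R u - truncRes 1 m R w with hT
  have hTb : ∀ m, ‖T m‖ ≤ ω * ‖u‖ := by
    intro m
    have h1 : Tendsto (fun k => truncRes f m R (truncRes 1 k Q u) -
        truncRes 1 m R (truncRes f k Q u)) atTop (𝓝 (T m)) :=
      (((truncRes f m R).continuous.tendsto _).comp (hQ.tendsto_truncRes_one hQd u)).sub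
        (((truncRes 1 m R).continuous.tendsto _).comp hw)
    exact le_of_tendsto h1.norm (Eventually.of_forall fun k =>
      ContinuousLinearMap.le_of_opNorm_le _ (h m k) u)
  have hcomp : ∀ k m, k + 1 ≤ m → truncRes 1 k R (T m) = T k := by
    intro k m hkm
    have hcomm : ∀ g : C(ℝ, ℂ), truncRes 1 k R * truncRes g m R = truncRes g k R := by
      intro g
      rw [← hR.truncRes_mul_one hkm g]
      exact cfc_commute_cfc _ _ _
    have e1 := congrArg (fun S : H →L[ℂ] H => S u) (hcomm f)
    have e2 := congrArg (fun S : H →L[ℂ] H => S w) (hcomm 1)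
    simp only [mul_apply_eq_comp] at e1 e2
    rw [hT]
    simp only [map_sub, e1, e2]
  -- As `T k` is the cut-off of `T m`, the squared norms increase; being bounded they converge, and
  -- this inequality makes `T` Cauchy.
  have hsq : ∀ k m, k + 1 ≤ m → ‖T m - T k‖ ^ 2 ≤ ‖T m‖ ^ 2 - ‖T k‖ ^ 2 := by
    intro k m hkm
    have := hR.norm_sub_truncRes_one_sq_le k (T m)
    rwa [hcomp k m hkm] at this
  have hmono : ∀ k m, k + 1 ≤ m → ‖T k‖ ^ 2 ≤ ‖T m‖ ^ 2 := fun k m hkm => by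
    linarith [hsq k m hkm, sq_nonneg ‖T m - T k‖]
  have hbdd : BddAbove (Set.range fun m => ‖T m‖ ^ 2) := by
    refine ⟨(ω * ‖u‖) ^ 2, ?_⟩
    rintro _ ⟨m, rfl⟩
    exact pow_le_pow_left₀ (norm_nonneg _) (hTb m) 2
  have hmono' : Monotone fun m => ‖T m‖ ^ 2 := monotone_nat_of_le_succ fun n => hmono n _ le_rfl
  have hlim := (tendsto_atTop_ciSup hmono' hbdd).cauchySeq
  have hcau : CauchySeq T := by
    rw [Metric.cauchySeq_iff'] at hlim ⊢
    intro ε hε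
    obtain ⟨N, hN⟩ := hlim (ε ^ 2) (by positivity)
    refine ⟨N, fun n hn => ?_⟩
    rcases hn.eq_or_lt with rfl | hlt
    · simpa using hε
    have h1 := hN n hn
    rw [Real.dist_eq] at h1
    have h2 := (hsq N n hlt).trans_lt ((le_abs_self _).trans_lt h1)
    rw [dist_eq_norm]
    exact lt_of_pow_lt_pow_left₀ 2 hε.le h2
  obtain ⟨v, hv⟩ := cauchySeq_tendsto_of_complete hcau
  refine ⟨v, ?_, le_of_tendsto hv.norm (Eventually.of_forall hTb)⟩
  refine (hv.add (hR.tendsto_truncRes_one hRd w)).congr fun m => ?_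
  simp [hT]

/-- By definition `truncated f A hA n` unfolds to `truncRes f n (resolventI A hA)`, so the limit
chosen in `fc` is the limit of these. -/
theorem fc_apply_eq (f : C(ℝ, ℂ)) {A : H →ₗ.[ℂ] H} (hA : IsSelfAdjoint A)
    (u : (fc f A hA).domain) {v : H}
    (h : Tendsto (fun n => truncRes f n (resolventI A hA) u) atTop (𝓝 v)) :
    fc f A hA u = v :=
  tendsto_nhds_unique u.2.choose_spec h

theorem tendsto_fc_apply (f : C(ℝ, ℂ)) {A : H →ₗ.[ℂ] H} (hA : IsSelfAdjoint A)
    (u : (fc f A hA).domain) :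
    Tendsto (fun n => truncRes f n (resolventI A hA) u) atTop (𝓝 (fc f A hA u)) :=
  u.2.choose_spec

/-- The vectors `φₙ(A)x` tend to `x`, and `(φₘ f)(A)φₙ(A)x` no longer depends on `m` once `m ≥ n +
1`. -/
theorem dense_fc_domain (f : C(ℝ, ℂ)) {A : H →ₗ.[ℂ] H} (hA : IsSelfAdjoint A) :
    Dense ((fc f A hA).domain : Set H) := by
  have hR := isResolventLike_resolventI hA
  intro x
  refine mem_closure_of_tendsto (hR.tendsto_truncRes_one (denseRange_resolventI hA) x)
    (Eventually.of_forall fun n => ?_)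
  refine ⟨truncRes f n (resolventI A hA) x, tendsto_const_nhds.congr' ?_⟩
  filter_upwards [eventually_ge_atTop (n + 1)] with m hm
  exact (congrArg (fun S : H →L[ℂ] H => S x) (hR.truncRes_mul_one hm f)).symm

theorem normDiff_le {G : Type u} [NormedAddCommGroup G] [InnerProductSpace ℂ G]
    {S T : G →ₗ.[ℂ] G} (K : G →L[ℂ] G) (h : S = (K : G →ₗ[ℂ] G) +ᵥ T) :
    normDiff S T ≤ ‖K‖ₑ := iInf₂_le K h

/-- Assuming the bound only for pairs with difference exactly `K` lets one statement serve both the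
modulus (`‖S - T‖ ≤ δ`) and uniform operator continuity (`‖S - T‖ < δ`). -/
theorem normDiff_fc_le_of_forall (f : C(ℝ, ℂ)) {A B : H →ₗ.[ℂ] H} (hA : IsSelfAdjoint A)
    (hB : IsSelfAdjoint B) {K : H →L[ℂ] H} (h : A = (K : H →ₗ[ℂ] H) +ᵥ B) {ω : ℝ}
    (hω : ∀ S T : H →L[ℂ] H, IsSelfAdjoint S → IsSelfAdjoint T → S - T = K →
      ‖fcBounded f S - fcBounded f T‖ ≤ ω) :
    normDiff (fc f A hA) (fc f B hB) ≤ ENNReal.ofReal ω := by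
  have hK := isSelfAdjoint_of_eq_vadd hA hB h
  have hω0 : 0 ≤ ω := (norm_nonneg _).trans
    (hω K 0 hK (IsSelfAdjoint.zero _) (sub_zero _))
  have h' : B = ((-K : H →L[ℂ] H) : H →ₗ[ℂ] H) +ᵥ A := by
    rw [h, ← add_vadd]
    simp
  have hω' : ∀ S T : H →L[ℂ] H, IsSelfAdjoint S → IsSelfAdjoint T → S - T = -K →
      ‖fcBounded f S - fcBounded f T‖ ≤ ω := fun S T hS hT hST => by
    rw [norm_sub_rev]
    exact hω T S hT hS (by rw [← neg_sub, hST, neg_neg])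
  have hBA : ∀ u : (fc f B hB).domain, ∃ v, Tendsto
      (fun m => truncRes f m (resolventI A hA) u) atTop (𝓝 (v + fc f B hB u)) ∧
      ‖v‖ ≤ ω * ‖(u : H)‖ := fun u =>
    exists_tendsto_truncRes f (isResolventLike_resolventI hA) (denseRange_resolventI hA)
      (isResolventLike_resolventI hB) (denseRange_resolventI hB)
      (norm_truncRes_commutator_le f hA hB h hω) (tendsto_fc_apply f hB u)
  have hAB : ∀ u : (fc f A hA).domain, ∃ v, Tendsto
      (fun m => truncRes f m (resolventI B hB) u) atTop (𝓝 (v + fc f A hA u)) ∧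
      ‖v‖ ≤ ω * ‖(u : H)‖ := fun u =>
    exists_tendsto_truncRes f (isResolventLike_resolventI hB) (denseRange_resolventI hB)
      (isResolventLike_resolventI hA) (denseRange_resolventI hA)
      (norm_truncRes_commutator_le f hB hA h' hω') (tendsto_fc_apply f hA u)
  have hdom : (fc f A hA).domain = (fc f B hB).domain := by
    apply le_antisymm
    · intro u hu
      obtain ⟨v, hv, -⟩ := hAB ⟨u, hu⟩
      exact ⟨_, hv⟩
    · intro u hu
      obtain ⟨v, hv, -⟩ := hBA ⟨u, hu⟩
      exact ⟨_, hv⟩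
  set D := (fc f B hB).domain with hD
  -- The difference `f(A) - f(B)` is bounded by `ω` on the dense common domain; its continuous
  -- extension is the required everywhere defined operator.
  let L : D →ₗ[ℂ] H :=
    (fc f A hA).toFun ∘ₗ Submodule.inclusion hdom.ge - (fc f B hB).toFun
  have hL : ∀ u : D, ‖L u‖ ≤ ω * ‖u‖ := by
    intro u
    obtain ⟨v, hv, hvn⟩ := hBA u
    have h1 : L u = v := by
      have h2 := fc_apply_eq f hA ⟨u, hdom.ge u.2⟩ hv
      change fc f A hA ⟨u, hdom.ge u.2⟩ - fc f B hB u = v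
      rw [h2, add_sub_cancel_right]
    rw [h1]
    exact hvn
  have hdense : DenseRange D.subtypeL := by
    have := dense_fc_domain f hB
    rwa [DenseRange, Submodule.coe_subtypeL, Submodule.coe_subtype, Subtype.range_coe]
  set M : H →L[ℂ] H := (L.mkContinuous ω hL).extend D.subtypeL with hM
  have hMeq : ∀ u : D, M u = L u := fun u =>
    ContinuousLinearMap.extend_eq (L.mkContinuous ω hL) hdense
      isUniformEmbedding_subtype_val.isUniformInducing u
  have hMn : ‖M‖ ≤ ω := by
    have := ContinuousLinearMap.opNorm_extend_le (L.mkContinuous ω hL) (e := D.subtypeL) (N := 1)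
      hdense (fun x => by simp)
    refine this.trans ?_
    simpa using L.mkContinuous_norm_le hω0 hL
  have hMadd : fc f A hA = (M : H →ₗ[ℂ] H) +ᵥ fc f B hB := by
    refine LinearPMap.ext hdom fun u hu₁ hu₂ => ?_
    rw [LinearPMap.vadd_apply]
    change _ = M u + fc f B hB ⟨u, hu₂⟩
    rw [hMeq ⟨u, hu₂⟩]
    change _ = (fc f A hA ⟨u, hu₁⟩ - fc f B hB ⟨u, hu₂⟩) + fc f B hB ⟨u, hu₂⟩
    rw [sub_add_cancel]
  refine (normDiff_le M hMadd).trans ?_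
  rw [← ofReal_norm]
  exact ENNReal.ofReal_le_ofReal hMn

theorem enorm_fcBounded_sub_le_operatorModulus (f : C(ℝ, ℂ)) {S T : H →L[ℂ] H}
    (hS : IsSelfAdjoint S) (hT : IsSelfAdjoint T) {δ : ℝ} (h : ‖S - T‖ ≤ δ) :
    ‖fcBounded f S - fcBounded f T‖ₑ ≤ operatorModulus.{u} f δ := by
  unfold operatorModulus
  exact le_iSup_of_le H <| le_iSup_of_le _ <| le_iSup_of_le _ <| le_iSup_of_le _ <|
    le_iSup_of_le S <| le_iSup_of_le T <| le_iSup_of_le hS <| le_iSup_of_le hT <|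
    le_iSup_of_le h le_rfl

theorem normDiff_fc_le_operatorModulus (f : C(ℝ, ℂ)) {A B : H →ₗ.[ℂ] H} (hA : IsSelfAdjoint A)
    (hB : IsSelfAdjoint B) {K : H →L[ℂ] H} (h : A = (K : H →ₗ[ℂ] H) +ᵥ B) :
    normDiff (fc f A hA) (fc f B hB) ≤ operatorModulus.{u} f ‖K‖ := by
  by_cases htop : operatorModulus.{u} f ‖K‖ = ⊤
  · rw [htop]; exact le_top
  rw [← ENNReal.ofReal_toReal htop]
  refine normDiff_fc_le_of_forall f hA hB h fun S T hS hT hST => ?_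
  have h1 := enorm_fcBounded_sub_le_operatorModulus f hS hT (congrArg norm hST).le
  rw [← ofReal_norm] at h1
  exact (ENNReal.ofReal_le_iff_le_toReal htop).mp h1

end OperatorModulus
end

noncomputable section
namespace OperatorModulus

open Filter Topology

/-! ### Orthogonal sums of bounded self-adjoint operators -/

section OrthogonalSum

variable {E : ℕ → Type u} [∀ n, NormedAddCommGroup (E n)] [∀ n, InnerProductSpace ℂ (E n)]

/-- The orthogonal sum of a sequence of bounded operators, with its maximal domain. -/
def orthogonalSum (A : ∀ n, E n →L[ℂ] E n) : lp E 2 →ₗ.[ℂ] lp E 2 where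
  domain :=
    { carrier := {x | Memℓp (fun n => A n (x n)) 2}
      zero_mem' := by
        have : (fun n => A n ((0 : lp E 2) n)) = 0 := by ext n; simp
        change Memℓp _ 2
        rw [this]
        exact zero_memℓp
      add_mem' := by
        intro x y hx hy
        have : (fun n => A n ((x + y) n)) = (fun n => A n (x n)) + fun n => A n (y n) := by
          ext n; simp
        change Memℓp _ 2
        rw [this]
        exact Memℓp.add hx hy
      smul_mem' := by
        intro c x hx
        have : (fun n => A n ((c • x) n)) = c • fun n => A n (x n) := by ext n; simp
        change Memℓp _ 2
        rw [this]
        exact Memℓp.const_smul hx c }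
  toFun :=
    { toFun := fun x => ⟨fun n => A n ((x : lp E 2) n), x.2⟩
      map_add' := fun x y => lp.ext (funext fun n => map_add (A n) _ _)
      map_smul' := fun c x => lp.ext (funext fun n => map_smul (A n) _ _) }

theorem mem_orthogonalSum_domain {A : ∀ n, E n →L[ℂ] E n} {x : lp E 2} :
    x ∈ (orthogonalSum A).domain ↔ Memℓp (fun n => A n (x n)) 2 := Iff.rfl

theorem orthogonalSum_apply {A : ∀ n, E n →L[ℂ] E n} (x : (orthogonalSum A).domain) (n : ℕ) :
    orthogonalSum A x n = A n ((x : lp E 2) n) := rfl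

theorem apply_single (A : ∀ n, E n →L[ℂ] E n) (i : ℕ) (a : E i) :
    (fun n => A n (lp.single (E := E) 2 i a n)) = lp.single (E := E) 2 i (A i a) := by
  ext n
  by_cases h : n = i
  · subst h; simp
  · rw [lp.single_apply_ne _ _ _ h, lp.single_apply_ne _ _ _ h, map_zero]

theorem single_mem_orthogonalSum_domain (A : ∀ n, E n →L[ℂ] E n) (i : ℕ) (a : E i) :
    lp.single (E := E) 2 i a ∈ (orthogonalSum A).domain := by
  rw [mem_orthogonalSum_domain, apply_single]
  exact lp.memℓp _

theorem orthogonalSum_single (A : ∀ n, E n →L[ℂ] E n) (i : ℕ) (a : E i) :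
    orthogonalSum A ⟨lp.single (E := E) 2 i a, single_mem_orthogonalSum_domain A i a⟩ =
      lp.single (E := E) 2 i (A i a) :=
  lp.ext (apply_single A i a)

theorem dense_orthogonalSum_domain (A : ∀ n, E n →L[ℂ] E n) :
    Dense ((orthogonalSum A).domain : Set (lp E 2)) := by
  intro x
  have h := lp.hasSum_single (E := E) (p := 2) (by simp) x
  refine mem_closure_of_tendsto h (Eventually.of_forall fun s => ?_)
  exact Submodule.sum_mem _ fun i _ => single_mem_orthogonalSum_domain A i _

/-- Changing one summand of an orthogonal sum is a bounded perturbation. -/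
theorem orthogonalSum_update (A : ∀ n, E n →L[ℂ] E n) (i : ℕ) (B : E i →L[ℂ] E i) :
    orthogonalSum (Function.update A i B) =
      ((lp.singleContinuousLinearMap ℂ E 2 i ∘L (B - A i) ∘L lp.evalCLM ℂ E 2 i :
        lp E 2 →L[ℂ] lp E 2) : lp E 2 →ₗ[ℂ] lp E 2) +ᵥ orthogonalSum A := by
  have key : ∀ x : lp E 2, (fun n => Function.update A i B n (x n)) =
      lp.single (E := E) 2 i ((B - A i) (x i)) + fun n => A n (x n) := by
    intro x
    ext n
    by_cases h : n = i
    · subst h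
      change _ = lp.single (E := E) 2 n ((B - A n) (x n)) n + A n (x n)
      simp
    · change _ = lp.single (E := E) 2 i ((B - A i) (x i)) n + A n (x n)
      rw [lp.single_apply_ne _ _ _ h, Function.update_of_ne h, zero_add]
  have hdom : (orthogonalSum (Function.update A i B)).domain = (orthogonalSum A).domain := by
    ext x
    rw [mem_orthogonalSum_domain, mem_orthogonalSum_domain, key]
    refine ⟨fun h => ?_, fun h => (lp.memℓp _).add h⟩
    have := h.sub (lp.memℓp (lp.single (E := E) 2 i ((B - A i) (x i))))
    rwa [add_sub_cancel_left] at this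
  refine LinearPMap.ext hdom fun x hx₁ hx₂ => ?_
  refine lp.ext ?_
  rw [LinearPMap.vadd_apply]
  exact key x

theorem norm_singleContinuousLinearMap_comp_evalCLM_le (i : ℕ) (T : E i →L[ℂ] E i) :
    ‖lp.singleContinuousLinearMap ℂ E 2 i ∘L T ∘L lp.evalCLM ℂ E 2 i‖ ≤ ‖T‖ := by
  refine ContinuousLinearMap.opNorm_le_bound _ (norm_nonneg _) fun x => ?_
  change ‖lp.single (E := E) 2 i (T (x i))‖ ≤ _
  rw [lp.norm_single (by simp)]
  exact (T.le_opNorm _).trans (by gcongr; exact lp.norm_apply_le_norm (by simp) x i)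

variable [∀ n, CompleteSpace (E n)]

/-- Testing against vectors of a single summand shows that the adjoint acts componentwise by `A n`,
so its domain lies in the maximal one. The other inclusion is termwise symmetry. -/
theorem isSelfAdjoint_orthogonalSum {A : ∀ n, E n →L[ℂ] E n} (hA : ∀ n, IsSelfAdjoint (A n)) :
    IsSelfAdjoint (orthogonalSum A) := by
  have hd := dense_orthogonalSum_domain A
  have hsymm : ∀ n (a b : E n), inner ℂ (A n a) b = inner ℂ a (A n b) := fun n =>
    ContinuousLinearMap.isSelfAdjoint_iff_isSymmetric.mp (hA n)
  rw [LinearPMap.isSelfAdjoint_def]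
  refine le_antisymm ?_ (LinearPMap.IsFormalAdjoint.le_adjoint hd fun x y => ?_)
  · have key : ∀ y : (orthogonalSum A).adjoint.domain,
        (fun n => A n ((y : lp E 2) n)) = (orthogonalSum A).adjoint y := by
      intro y
      ext i
      refine ext_inner_right ℂ fun a => ?_
      have h := LinearPMap.adjoint_isFormalAdjoint (T := orthogonalSum A) hd y
        ⟨lp.single (E := E) 2 i a, single_mem_orthogonalSum_domain A i a⟩
      rw [orthogonalSum_single] at h
      simp only [lp.inner_single_right] at h
      rw [h, hsymm]
    refine ⟨fun y hy => ?_, fun y y' hyy' => ?_⟩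
    · rw [mem_orthogonalSum_domain, key ⟨y, hy⟩]
      exact lp.memℓp _
    · refine lp.ext ?_
      rw [← key y]
      ext n
      rw [orthogonalSum_apply, hyy']
  · refine (lp.hasSum_inner _ _).unique ?_
    convert lp.hasSum_inner (x : lp E 2) (orthogonalSum A y) using 2 with n
    exact hsymm n _ _

theorem resolventI_orthogonalSum_apply {A : ∀ n, E n →L[ℂ] E n} (hA : ∀ n, IsSelfAdjoint (A n))
    (y : lp E 2) (n : ℕ) :
    resolventI (orthogonalSum A) (isSelfAdjoint_orthogonalSum hA) y n =
      cfc (fun z : ℂ => (z.re + Complex.I)⁻¹) (A n) (y n) := by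
  obtain ⟨x, hx, hy⟩ := resolventI_spec (isSelfAdjoint_orthogonalSum hA) y
  rw [← hx]
  have h1 : A n ((x : lp E 2) n) + Complex.I • (x : lp E 2) n = y n := by
    rw [← hy]; rfl
  have h2 := congrArg (fun T : E n →L[ℂ] E n => T ((x : lp E 2) n)) (cfc_inv_add_I_mul (hA n))
  simp only [mul_apply_eq_comp, add_apply, smul_apply, one_apply_eq_self] at h2
  rw [← h1, h2]

theorem truncRes_orthogonalSum_single {A : ∀ n, E n →L[ℂ] E n} (hA : ∀ n, IsSelfAdjoint (A n))
    (f : C(ℝ, ℂ)) (m i : ℕ) (a : E i) :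
    truncRes f m (resolventI (orthogonalSum A) (isSelfAdjoint_orthogonalSum hA))
      (lp.single (E := E) 2 i a) =
    lp.single (E := E) 2 i
      (truncRes f m (cfc (fun z : ℂ => (z.re + Complex.I)⁻¹) (A i)) a) := by
  refine truncRes_comp (isResolventLike_resolventI _) (isResolventLike_cfc (hA i))
    (lp.singleContinuousLinearMap ℂ E 2 i) (fun x => ?_) (fun x => ?_) f m a
  · refine lp.ext (funext fun n => ?_)
    rw [resolventI_orthogonalSum_apply hA]
    exact congrFun (apply_single
      (fun n => cfc (fun z : ℂ => (z.re + Complex.I)⁻¹) (A n)) i x) n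
  · refine ext_inner_right ℂ fun y => ?_
    change inner ℂ (star (resolventI (orthogonalSum A) _) (lp.single (E := E) 2 i x)) y =
      inner ℂ (lp.single (E := E) 2 i _) y
    rw [lp.inner_single_left, ContinuousLinearMap.star_eq_adjoint,
      ContinuousLinearMap.star_eq_adjoint, ContinuousLinearMap.adjoint_inner_left,
      ContinuousLinearMap.adjoint_inner_left, lp.inner_single_left,
      resolventI_orthogonalSum_apply hA]

/-- The spectrum is bounded, so for large `n` the cut-off is `1` on it. -/
theorem truncRes_cfc_eq_fcBounded {H : Type u} [NormedAddCommGroup H] [InnerProductSpace ℂ H]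
    [CompleteSpace H] (f : C(ℝ, ℂ)) {A : H →L[ℂ] H} (hA : IsSelfAdjoint A) :
    ∀ᶠ n in atTop, truncRes f n (cfc (fun z : ℂ => (z.re + Complex.I)⁻¹) A) = fcBounded f A := by
  obtain ⟨C, hC⟩ := (spectrum.isCompact (𝕜 := ℂ) A).isBounded.exists_norm_le
  filter_upwards [eventually_ge_atTop ⌈C⌉₊] with n hn
  rw [truncRes_cfc f n hA, fcBounded]
  refine cfc_congr fun z hz => ?_
  have h1 : |z.re| ≤ n :=
    (Complex.abs_re_le_norm z).trans ((hC z hz).trans ((Nat.le_ceil C).trans (by exact_mod_cast hn)))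
  simp only [cutoff_eq_one h1, Complex.ofReal_one, one_mul]

theorem tendsto_truncRes_orthogonalSum_single {A : ∀ n, E n →L[ℂ] E n}
    (hA : ∀ n, IsSelfAdjoint (A n)) (f : C(ℝ, ℂ)) (i : ℕ) (a : E i) :
    Tendsto (fun m => truncRes f m
      (resolventI (orthogonalSum A) (isSelfAdjoint_orthogonalSum hA)) (lp.single (E := E) 2 i a))
      atTop (𝓝 (lp.single (E := E) 2 i (fcBounded f (A i) a))) := by
  refine tendsto_const_nhds.congr' ?_
  filter_upwards [truncRes_cfc_eq_fcBounded f (hA i)] with m hm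
  rw [truncRes_orthogonalSum_single hA, hm]

end OrthogonalSum

/-! ### Operator continuity versus uniform operator continuity -/

theorem OperatorContinuous.uniformlyOperatorContinuous {f : C(ℝ, ℂ)}
    (hf : OperatorContinuous.{u} f) : UniformlyOperatorContinuous.{u} f := by
  intro ε hε
  by_contra! hcon
  -- All the bad pairs are collected into the single self-adjoint operator `⊕ Aₙ`, at which operator
  -- continuity supplies one `δ`.
  choose E i1 i2 i3 A B hA hB hAB hfAB using fun n : ℕ => hcon (1 / ((n : ℝ) + 1)) (by positivity)
  obtain ⟨δ, hδ, h⟩ := hf (lp E 2) (orthogonalSum A) (isSelfAdjoint_orthogonalSum hA)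
    (ENNReal.ofReal ε) (by simpa using hε)
  obtain ⟨N, hN⟩ : ∃ N : ℕ, ENNReal.ofReal (1 / ((N : ℝ) + 1)) < δ := by
    have h1 := ENNReal.tendsto_ofReal (tendsto_one_div_add_atTop_nhds_zero_nat (𝕜 := ℝ))
    rw [ENNReal.ofReal_zero] at h1
    exact (h1.eventually_lt_const hδ).exists
  have hB' : ∀ n, IsSelfAdjoint (Function.update A N (B N) n) := by
    intro n
    by_cases hn : n = N
    · subst hn; simpa using hB n
    · simpa [hn] using hA n
  have hlt := h _ (isSelfAdjoint_orthogonalSum hB') (by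
    refine (normDiff_le _ (orthogonalSum_update A N (B N))).trans_lt (lt_of_le_of_lt ?_ hN)
    rw [← ofReal_norm]
    refine ENNReal.ofReal_le_ofReal
      ((norm_singleContinuousLinearMap_comp_evalCLM_le N _).trans ?_)
    rw [norm_sub_rev]
    exact (hAB N).le)
  obtain ⟨T, hT, hTε⟩ : ∃ T : lp E 2 →L[ℂ] lp E 2,
      fc f (orthogonalSum (Function.update A N (B N))) (isSelfAdjoint_orthogonalSum hB') =
        (T : lp E 2 →ₗ[ℂ] lp E 2) +ᵥ fc f (orthogonalSum A) (isSelfAdjoint_orthogonalSum hA) ∧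
      ‖T‖ₑ < ENNReal.ofReal ε := by
    simpa [normDiff, iInf_lt_iff] using hlt
  rw [← ofReal_norm, ENNReal.ofReal_lt_ofReal_iff hε] at hTε
  refine absurd (hfAB N) (not_le.mpr (lt_of_le_of_lt ?_ hTε))
  refine ContinuousLinearMap.opNorm_le_bound _ (norm_nonneg _) fun a => ?_
  have hta := tendsto_truncRes_orthogonalSum_single hA f N a
  have htb := tendsto_truncRes_orthogonalSum_single hB' f N a
  rw [Function.update_self] at htb
  have hma : lp.single (E := E) 2 N a ∈ (fc f _ (isSelfAdjoint_orthogonalSum hA)).domain := ⟨_, hta⟩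
  have hmb : lp.single (E := E) 2 N a ∈ (fc f _ (isSelfAdjoint_orthogonalSum hB')).domain :=
    ⟨_, htb⟩
  have e1 := fc_apply_eq f (isSelfAdjoint_orthogonalSum hA) ⟨_, hma⟩ hta
  have e2 := fc_apply_eq f (isSelfAdjoint_orthogonalSum hB') ⟨_, hmb⟩ htb
  have e3 : lp.single (E := E) 2 N (fcBounded f (B N) a) =
      T (lp.single (E := E) 2 N a) + lp.single (E := E) 2 N (fcBounded f (A N) a) := by
    rw [← e1, ← e2]
    have := (LinearPMap.ext_iff.mp hT).2 (x := lp.single (E := E) 2 N a) (hf := hmb) (hg := hma)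
    exact this
  -- On the `N`th summand `T` acts as `f(B_N) - f(A_N)`, so `‖T‖ < ε` contradicts the choice of the
  -- pair.
  have e4 : lp.single (E := E) 2 N ((fcBounded f (A N) - fcBounded f (B N)) a) =
      -T (lp.single (E := E) 2 N a) := by
    rw [sub_apply, lp.single_sub, e3]; abel
  rw [← lp.norm_single (E := E) (p := 2) (by simp) N, e4, norm_neg,
    ← lp.norm_single (E := E) (p := 2) (by simp) N a]
  exact T.le_opNorm _

theorem UniformlyOperatorContinuous.operatorContinuous {f : C(ℝ, ℂ)}
    (hf : UniformlyOperatorContinuous.{u} f) : OperatorContinuous.{u} f := by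
  intro H _ _ _ A hA ε hε
  -- A real `r` strictly below `ε` is needed: `ε` may be infinite, and the transfer estimate gives
  -- only `≤ r`.
  obtain ⟨r, hr, hrε⟩ : ∃ r : ℝ, 0 < r ∧ ENNReal.ofReal r < ε := by
    obtain ⟨q, hq0, hqε⟩ := ENNReal.lt_iff_exists_real_btwn.mp hε
    exact ⟨q, by simpa using hqε.1, hqε.2⟩
  obtain ⟨δ, hδ, h⟩ := hf r hr
  refine ⟨ENNReal.ofReal δ, by simpa using hδ, fun B hB hBA => lt_of_le_of_lt ?_ hrε⟩
  obtain ⟨K, hK, hKδ⟩ : ∃ K : H →L[ℂ] H, B = (K : H →ₗ[ℂ] H) +ᵥ A ∧ ‖K‖ₑ < ENNReal.ofReal δ := by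
    simpa [normDiff, iInf_lt_iff] using hBA
  rw [← ofReal_norm, ENNReal.ofReal_lt_ofReal_iff hδ] at hKδ
  exact normDiff_fc_le_of_forall f hB hA hK fun S T hS hT hST =>
    (h H S T hS hT (by rwa [hST])).le

end OperatorModulus
end

noncomputable section
namespace OperatorModulus

variable {H : Type u} [NormedAddCommGroup H] [InnerProductSpace ℂ H] [CompleteSpace H]
open Filter Topology MeasureTheory

/-! ### Poisson integrals are operator Lipschitz -/

/-- The function `x ↦ (x - (y + i h))⁻¹` whose values at operators are resolvents. -/
def resolventAt (h y : ℝ) (z : ℂ) : ℂ := (((z.re - y : ℝ) : ℂ) - h * Complex.I)⁻¹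

/-- The Poisson kernel of the half-plane without its normalization. -/
def poissonKernel (h y x : ℝ) : ℝ := h / ((x - y) ^ 2 + h ^ 2)

/-! ### Scalar estimates for the Poisson kernel -/

section Kernel

variable {h : ℝ} (y : ℝ)

theorem resolventAt_denom_ne_zero (hh : 0 < h) (x : ℝ) : (x : ℂ) - h * Complex.I ≠ 0 := fun e => by
  have := congrArg Complex.im e
  simp at this
  exact hh.ne' this

theorem continuous_resolventAt (hh : 0 < h) : Continuous (resolventAt h y) :=
  Continuous.inv₀ (by fun_prop) fun _ => resolventAt_denom_ne_zero hh _

theorem continuous_poissonKernel (hh : 0 < h) :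
    Continuous fun p : ℝ × ℂ => poissonKernel h p.1 p.2.re :=
  Continuous.div (by fun_prop) (by fun_prop) fun _ => by positivity

theorem poissonKernel_nonneg (hh : 0 < h) (x : ℝ) : 0 ≤ poissonKernel h y x := by
  unfold poissonKernel; positivity

theorem star_resolventAt_mul (hh : 0 < h) (z : ℂ) :
    star (resolventAt h y z) * resolventAt h y z = (h : ℂ)⁻¹ * (poissonKernel h y z.re : ℂ) := by
  have h1 : star (resolventAt h y z) * resolventAt h y z = (Complex.normSq (resolventAt h y z) : ℂ) :=
    (Complex.normSq_eq_conj_mul_self).symm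
  rw [h1, ← Complex.ofReal_inv, ← Complex.ofReal_mul]
  congr 1
  have h2 : Complex.normSq (((z.re - y : ℝ) : ℂ) - h * Complex.I) = (z.re - y) ^ 2 + h ^ 2 := by
    simp [Complex.normSq_apply]; ring
  rw [resolventAt, Complex.normSq_inv, h2, poissonKernel]
  have : (z.re - y) ^ 2 + h ^ 2 ≠ 0 := by positivity
  field_simp

theorem poissonKernel_eq (z : ℂ) :
    (poissonKernel h y z.re : ℂ) =
      (2 * Complex.I)⁻¹ * (resolventAt h y z - star (resolventAt h y z)) := by
  have h2 : resolventAt h y z - star (resolventAt h y z) =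
      2 * Complex.I * (resolventAt h y z).im := by
    apply Complex.ext <;> simp; ring
  rw [h2, ← mul_assoc, inv_mul_cancel₀ (by simp), one_mul]
  congr 1
  rw [resolventAt, Complex.inv_im, Complex.normSq_apply, poissonKernel]
  simp
  ring

theorem integrable_inv_one_add_sq_complex {F : ℝ → ℂ} (hF : Continuous F) {M : ℝ}
    (hM : ∀ t, ‖F t‖ ≤ M) : Integrable fun s : ℝ => F s * ((1 + s ^ 2)⁻¹ : ℝ) := by
  refine (integrable_inv_one_add_sq.const_mul M).mono' ?_ (Eventually.of_forall fun s => ?_)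
  · refine (hF.mul (Complex.continuous_ofReal.comp ?_)).aestronglyMeasurable
    exact Continuous.inv₀ (by fun_prop) fun s => by positivity
  · rw [norm_mul, Complex.norm_real, Real.norm_of_nonneg (by positivity)]
    exact mul_le_mul_of_nonneg_right (hM s) (by positivity)

theorem integral_mul_poissonKernel (hh : 0 < h) (F : ℝ → ℂ) (x : ℝ) :
    ∫ y, F y * (poissonKernel h y x : ℂ) = ∫ s, F (x + h * s) * ((1 + s ^ 2)⁻¹ : ℝ) := by
  rw [← integral_add_left_eq_self (μ := volume) (fun y => F y * (poissonKernel h y x : ℂ)) x]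
  have h1 := Measure.integral_comp_mul_left
    (fun t : ℝ => F (x + t) * (poissonKernel h (x + t) x : ℂ)) h
  have h2 : ∫ t, F (x + t) * (poissonKernel h (x + t) x : ℂ) =
      h • ∫ s, F (x + h * s) * (poissonKernel h (x + h * s) x : ℂ) := by
    rw [h1, abs_of_pos (by positivity), smul_smul, mul_inv_cancel₀ hh.ne', one_smul]
  rw [h2, ← integral_smul]
  congr 1
  ext s
  rw [Complex.real_smul, mul_left_comm, ← Complex.ofReal_mul]
  congr 2
  unfold poissonKernel
  have : (1 + s ^ 2) ≠ 0 := by positivity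
  have h3 : (x - (x + h * s)) ^ 2 + h ^ 2 = h * (h * (1 + s ^ 2)) := by ring
  rw [h3]
  field_simp

theorem integral_poissonKernel (hh : 0 < h) (x : ℝ) :
    ∫ y, (poissonKernel h y x : ℂ) = (Real.pi : ℂ) := by
  have := integral_mul_poissonKernel hh (fun _ => 1) x
  simp only [one_mul] at this
  rw [this, integral_complex_ofReal, integral_univ_inv_one_add_sq]

theorem continuous_integral_mul_poissonKernel (hh : 0 < h) {F : ℝ → ℂ} (hF : Continuous F) {M : ℝ}
    (hM : ∀ t, ‖F t‖ ≤ M) : Continuous fun x : ℝ => ∫ y, F y * (poissonKernel h y x : ℂ) := by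
  simp only [integral_mul_poissonKernel hh]
  refine continuous_of_dominated (bound := fun s => M * (1 + s ^ 2)⁻¹) (fun x => ?_) (fun x => ?_)
    (integrable_inv_one_add_sq.const_mul M) ?_
  · exact (integrable_inv_one_add_sq_complex (F := fun s => F (x + h * s)) (by fun_prop)
      fun t => hM _).aestronglyMeasurable
  · refine Eventually.of_forall fun s => ?_
    rw [norm_mul, Complex.norm_real, Real.norm_of_nonneg (by positivity)]
    exact mul_le_mul_of_nonneg_right (hM _) (by positivity)
  · exact Eventually.of_forall fun s => by fun_prop

/-- Poisson integrals approximate bounded uniformly continuous functions uniformly. -/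
theorem exists_poisson_approx {F : ℝ → ℂ} (hF : UniformContinuous F) {M : ℝ}
    (hM : ∀ t, ‖F t‖ ≤ M) {ε : ℝ} (hε : 0 < ε) :
    ∃ h : ℝ, 0 < h ∧ ∀ x : ℝ,
      ‖(∫ y, F y * (poissonKernel h y x : ℂ)) - Real.pi * F x‖ ≤ Real.pi * ε := by
  have hM0 : 0 ≤ M := (norm_nonneg _).trans (hM 0)
  have hk : Integrable fun s : ℝ => (1 + s ^ 2)⁻¹ := integrable_inv_one_add_sq
  have hlim := intervalIntegral_tendsto_integral hk
    (tendsto_neg_atTop_atBot.comp tendsto_natCast_atTop_atTop) tendsto_natCast_atTop_atTop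
    (l := (atTop : Filter ℕ))
  rw [integral_univ_inv_one_add_sq] at hlim
  -- The mass of `(1 + s²)⁻¹` outside `[-L, L]` is made so small that, weighted by `2M`, it costs at
  -- most `πε/2`. The central part costs `πε/2`, since `h = η/(L+1)` gives `h|s| < η` there.
  obtain ⟨L, hL⟩ := (hlim.eventually_const_lt
    (show Real.pi - Real.pi * ε / (4 * (M + 1)) < Real.pi by
      have := Real.pi_pos
      have : 0 < Real.pi * ε / (4 * (M + 1)) := by positivity
      linarith)).exists
  obtain ⟨η, hη, hFη⟩ := Metric.uniformContinuous_iff.mp hF (ε / 2) (by positivity)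
  refine ⟨η / (L + 1), by positivity, fun x => ?_⟩
  set h := η / ((L : ℝ) + 1) with hdef
  have hh : 0 < h := by positivity
  have hcF := hF.continuous
  have e1 : (Real.pi : ℂ) * F x = ∫ s : ℝ, F x * ((1 + s ^ 2)⁻¹ : ℝ) := by
    rw [integral_const_mul, integral_complex_ofReal, integral_univ_inv_one_add_sq, mul_comm]
  rw [integral_mul_poissonKernel hh, e1, ← integral_sub
    (integrable_inv_one_add_sq_complex (F := fun s => F (x + h * s)) (by fun_prop) fun t => hM _)
    (integrable_inv_one_add_sq_complex (F := fun s => F x) (by fun_prop) fun t => hM _)]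
  have hind : Integrable (Set.indicator (Set.Ioc (-(L : ℝ)) L) fun s : ℝ => (1 + s ^ 2)⁻¹) :=
    hk.indicator measurableSet_Ioc
  have hg : Integrable fun s : ℝ => ε / 2 * (1 + s ^ 2)⁻¹ + 2 * M * ((1 + s ^ 2)⁻¹ -
      Set.indicator (Set.Ioc (-(L : ℝ)) L) (fun s : ℝ => (1 + s ^ 2)⁻¹) s) :=
    (hk.const_mul _).add ((hk.sub hind).const_mul _)
  refine (norm_integral_le_of_norm_le hg (Eventually.of_forall fun s => ?_)).trans ?_
  · rw [← sub_mul, norm_mul, Complex.norm_real, Real.norm_of_nonneg (by positivity)]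
    by_cases hs : s ∈ Set.Ioc (-(L : ℝ)) L
    · rw [Set.indicator_of_mem hs, sub_self, mul_zero, add_zero]
      refine mul_le_mul_of_nonneg_right ?_ (by positivity)
      rw [← dist_eq_norm]
      refine (hFη ?_).le
      rw [dist_eq_norm, add_sub_cancel_left, norm_mul, Real.norm_of_nonneg hh.le, Real.norm_eq_abs,
        hdef, div_mul_eq_mul_div, div_lt_iff₀ (by positivity)]
      have : |s| ≤ L := abs_le.mpr ⟨hs.1.le, hs.2⟩
      nlinarith
    · rw [Set.indicator_of_notMem hs, sub_zero, ← add_mul]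
      refine mul_le_mul_of_nonneg_right ?_ (by positivity)
      have := norm_sub_le (F (x + h * s)) (F x)
      linarith [hM (x + h * s), hM x]
  · have hsub : Integrable fun s : ℝ => (1 + s ^ 2)⁻¹ -
        Set.indicator (Set.Ioc (-(L : ℝ)) L) (fun s : ℝ => (1 + s ^ 2)⁻¹) s := hk.sub hind
    rw [integral_add (hk.const_mul _) (hsub.const_mul _), integral_const_mul,
      integral_const_mul, integral_sub hk hind, integral_indicator measurableSet_Ioc,
      integral_univ_inv_one_add_sq,
      ← intervalIntegral.integral_of_le (by linarith [L.cast_nonneg (α := ℝ)])]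
    have h5 : 2 * M * (Real.pi - ∫ s in (-(L : ℝ))..L, (1 + s ^ 2)⁻¹) ≤
        2 * M * (Real.pi * ε / (4 * (M + 1))) := by
      refine mul_le_mul_of_nonneg_left ?_ (by positivity)
      have h6 : Real.pi - Real.pi * ε / (4 * (M + 1)) < ∫ s in (-(L : ℝ))..L, (1 + s ^ 2)⁻¹ := hL
      linarith
    have h7 : 2 * M * (Real.pi * ε / (4 * (M + 1))) ≤ Real.pi * ε / 2 := by
      rw [← mul_div_assoc, div_le_div_iff₀ (by positivity) (by positivity)]
      have : 0 < Real.pi * ε := mul_pos Real.pi_pos hε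
      nlinarith
    linarith

end Kernel

/-- Take `v` parallel to `T u` with `‖v‖ = ‖u‖`. The additive form of the hypothesis is what
integrating quadratic forms produces. -/
theorem opNorm_le_of_forall_norm_inner_le {G : Type*} [NormedAddCommGroup G]
    [InnerProductSpace ℂ G] {T : G →L[ℂ] G} {c : ℝ} (hc : 0 ≤ c)
    (h : ∀ u v, ‖inner ℂ v (T u)‖ ≤ c / 2 * (‖u‖ ^ 2 + ‖v‖ ^ 2)) : ‖T‖ ≤ c := by
  refine ContinuousLinearMap.opNorm_le_bound _ hc fun u => ?_
  by_cases hu : u = 0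
  · simp [hu]
  by_cases hT : T u = 0
  · rw [hT, norm_zero]; positivity
  have hu' := norm_pos_iff.mpr hu
  have hT' := norm_pos_iff.mpr hT
  have h1 := h u (((‖u‖ / ‖T u‖ : ℝ) : ℂ) • T u)
  rw [inner_smul_left, norm_mul, norm_smul, Complex.conj_ofReal, Complex.norm_real,
    Real.norm_of_nonneg (by positivity), inner_self_eq_norm_sq_to_K, div_mul_cancel₀ _ hT'.ne'] at h1
  simp only [norm_pow, RCLike.norm_ofReal, abs_norm] at h1
  have h2 : ‖u‖ / ‖T u‖ * ‖T u‖ ^ 2 = ‖u‖ * ‖T u‖ := by field_simp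
  rw [h2] at h1
  refine le_of_mul_le_mul_left ?_ hu'
  linarith

/-! ### Poisson kernels of bounded self-adjoint operators -/

section Operators

variable {h : ℝ} {A B : H →L[ℂ] H}

theorem continuous_poissonKernel_re (hh : 0 < h) (y : ℝ) :
    Continuous fun z : ℂ => (poissonKernel h y z.re : ℂ) :=
  Complex.continuous_ofReal.comp ((continuous_poissonKernel hh).comp (by fun_prop :
    Continuous fun z : ℂ => ((y, z) : ℝ × ℂ)))

theorem cfc_resolventAt_mul (hh : 0 < h) (hA : IsSelfAdjoint A) (y : ℝ) :
    cfc (resolventAt h y) A * (A - ((y : ℂ) + h * Complex.I) • 1) = 1 ∧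
      (A - ((y : ℂ) + h * Complex.I) • 1) * cfc (resolventAt h y) A = 1 := by
  have := hA.isStarNormal
  have h1 : A - ((y : ℂ) + h * Complex.I) • 1 =
      cfc (fun z : ℂ => z - ((y : ℂ) + h * Complex.I)) A := by
    rw [cfc_sub (R := ℂ) (a := A) (fun z => z) (fun _ => ((y : ℂ) + h * Complex.I)), cfc_id' ℂ A,
      cfc_const _ A, Algebra.algebraMap_eq_smul_one]
  have hc := continuous_resolventAt (h := h) y hh
  have h2 : ∀ z ∈ spectrum ℂ A, resolventAt h y z * (z - ((y : ℂ) + h * Complex.I)) = 1 := by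
    intro z hz
    have hz' := hA.mem_spectrum_eq_re hz
    have h3 : z - ((y : ℂ) + h * Complex.I) = ((z.re - y : ℝ) : ℂ) - h * Complex.I := by
      conv_lhs => rw [hz']
      push_cast; ring
    rw [resolventAt, h3, inv_mul_cancel₀ (resolventAt_denom_ne_zero hh _)]
  rw [h1, ← cfc_mul (R := ℂ) _ _ A hc.continuousOn, ← cfc_mul (R := ℂ) _ _ A (by fun_prop)
    hc.continuousOn, ← cfc_const_one ℂ A]
  refine ⟨cfc_congr h2, cfc_congr fun z hz => ?_⟩
  rw [mul_comm]
  exact h2 z hz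

theorem cfc_resolventAt_sub (hh : 0 < h) (hA : IsSelfAdjoint A) (hB : IsSelfAdjoint B) (y : ℝ) :
    cfc (resolventAt h y) A - cfc (resolventAt h y) B =
      cfc (resolventAt h y) A * (B - A) * cfc (resolventAt h y) B := by
  have hA' := (cfc_resolventAt_mul hh hA y).1
  have hB' := (cfc_resolventAt_mul hh hB y).2
  have h1 : B - A = (B - ((y : ℂ) + h * Complex.I) • 1) - (A - ((y : ℂ) + h * Complex.I) • 1) := by
    abel
  rw [h1, mul_sub, sub_mul, mul_assoc, hB', hA', mul_one, one_mul]

theorem norm_cfc_resolventAt_sq (hh : 0 < h) (hA : IsSelfAdjoint A) (y : ℝ) (u : H) :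
    ‖cfc (resolventAt h y) A u‖ ^ 2 =
      h⁻¹ * (inner ℂ u (cfc (fun z : ℂ => (poissonKernel h y z.re : ℂ)) A u)).re := by
  have := hA.isStarNormal
  have hc := continuous_resolventAt (h := h) y hh
  have h1 : star (cfc (resolventAt h y) A) * cfc (resolventAt h y) A =
      (h : ℂ)⁻¹ • cfc (fun z : ℂ => (poissonKernel h y z.re : ℂ)) A := by
    rw [← cfc_star, ← cfc_mul (R := ℂ) _ _ A hc.star.continuousOn hc.continuousOn,
      ← cfc_const_mul (R := ℂ) (h : ℂ)⁻¹ (fun z : ℂ => (poissonKernel h y z.re : ℂ)) A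
        (continuous_poissonKernel_re hh y).continuousOn]
    refine cfc_congr fun z _ => ?_
    exact star_resolventAt_mul y hh z
  have h2 : inner ℂ u ((star (cfc (resolventAt h y) A) * cfc (resolventAt h y) A) u) =
      inner ℂ (cfc (resolventAt h y) A u) (cfc (resolventAt h y) A u) := by
    generalize cfc (resolventAt h y) A = R
    exact ContinuousLinearMap.adjoint_inner_right R u (R u)
  have h3 : (inner ℂ (cfc (resolventAt h y) A u) (cfc (resolventAt h y) A u)).re =
    ‖cfc (resolventAt h y) A u‖ ^ 2 := inner_self_eq_norm_sq (𝕜 := ℂ) _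
  rw [← h3, ← h2, h1, smul_apply, inner_smul_right, ← Complex.ofReal_inv, Complex.re_ofReal_mul]

theorem cfc_poissonKernel_eq (hh : 0 < h) (A : H →L[ℂ] H) (y : ℝ) :
    cfc (fun z : ℂ => (poissonKernel h y z.re : ℂ)) A =
      (2 * Complex.I)⁻¹ • (cfc (resolventAt h y) A - star (cfc (resolventAt h y) A)) := by
  have hc := continuous_resolventAt (h := h) y hh
  rw [← cfc_star, ← cfc_sub (R := ℂ) (a := A) (resolventAt h y)
      (fun z => star (resolventAt h y z)) hc.continuousOn hc.star.continuousOn,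
    ← cfc_const_mul (R := ℂ) (2 * Complex.I)⁻¹
      (fun z => resolventAt h y z - star (resolventAt h y z)) A (hc.sub hc.star).continuousOn]
  exact cfc_congr fun z _ => poissonKernel_eq y z

/-- The kernel is the imaginary part of the resolvent, so the difference is the imaginary part of `D
= R_A (B - A) R_B`. By Cauchy–Schwarz and `2ab ≤ a² + b²` it is controlled by `‖R_A* ·‖²` and `‖R_B
·‖²`, which are `h⁻¹` times quadratic forms of the kernel and hence integrable in `y`. -/
theorem norm_inner_cfc_poissonKernel_sub_le (hh : 0 < h) (hA : IsSelfAdjoint A)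
    (hB : IsSelfAdjoint B) (y : ℝ) (u v : H) :
    ‖inner ℂ v ((cfc (fun z : ℂ => (poissonKernel h y z.re : ℂ)) A -
        cfc (fun z : ℂ => (poissonKernel h y z.re : ℂ)) B) u)‖ ≤
      ‖A - B‖ / (4 * h) *
        (((inner ℂ v (cfc (fun z : ℂ => (poissonKernel h y z.re : ℂ)) A v)).re +
          (inner ℂ u (cfc (fun z : ℂ => (poissonKernel h y z.re : ℂ)) B u)).re) +
        ((inner ℂ v (cfc (fun z : ℂ => (poissonKernel h y z.re : ℂ)) B v)).re +
          (inner ℂ u (cfc (fun z : ℂ => (poissonKernel h y z.re : ℂ)) A u)).re)) := by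
  set PA := cfc (fun z : ℂ => (poissonKernel h y z.re : ℂ)) A with hPA
  set PB := cfc (fun z : ℂ => (poissonKernel h y z.re : ℂ)) B with hPB
  set RA := cfc (resolventAt h y) A with hRA
  set RB := cfc (resolventAt h y) B with hRB
  set D := RA * (B - A) * RB with hD
  have hRD : RA - RB = D := cfc_resolventAt_sub hh hA hB y
  have e1 : PA - PB = (2 * Complex.I)⁻¹ • (D - star D) := by
    rw [hPA, hPB, cfc_poissonKernel_eq hh A, cfc_poissonKernel_eq hh B, ← smul_sub, ← hRD,
      star_sub]
    congr 1
    abel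
  have hnA : ∀ w, ‖star RA w‖ = ‖RA w‖ := fun w =>
    (ContinuousLinearMap.isStarNormal_iff_norm_eq_adjoint.mp (cfc_predicate _ _) w).symm
  have sA : ∀ w, ‖star RA w‖ ^ 2 = h⁻¹ * (inner ℂ w (PA w)).re := fun w => by
    rw [hnA]; exact norm_cfc_resolventAt_sq hh hA y w
  have sB : ∀ w, ‖RB w‖ ^ 2 = h⁻¹ * (inner ℂ w (PB w)).re :=
    norm_cfc_resolventAt_sq hh hB y
  have hDuv : ∀ a b, ‖inner ℂ a (D b)‖ ≤
      ‖A - B‖ / (2 * h) * ((inner ℂ a (PA a)).re + (inner ℂ b (PB b)).re) := by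
    intro a b
    have h1 : inner ℂ a (D b) = inner ℂ (star RA a) ((B - A) (RB b)) :=
      (ContinuousLinearMap.adjoint_inner_left RA _ _).symm
    rw [h1]
    calc _ ≤ ‖star RA a‖ * ‖(B - A) (RB b)‖ := norm_inner_le_norm _ _
      _ ≤ ‖star RA a‖ * (‖A - B‖ * ‖RB b‖) := by
        gcongr; rw [norm_sub_rev A B]; exact ContinuousLinearMap.le_opNorm _ _
      _ ≤ ‖A - B‖ / 2 * (‖star RA a‖ ^ 2 + ‖RB b‖ ^ 2) := by
        nlinarith [norm_nonneg (A - B), mul_nonneg (norm_nonneg (A - B))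
          (sq_nonneg (‖star RA a‖ - ‖RB b‖))]
      _ = _ := by rw [sA, sB]; field_simp
  have e2 : inner ℂ v ((PA - PB) u) =
      (2 * Complex.I)⁻¹ * (inner ℂ v (D u) - inner ℂ (D v) u) := by
    rw [e1, smul_apply, inner_smul_right, sub_apply, inner_sub_right]
    congr 2
    exact ContinuousLinearMap.adjoint_inner_right D _ _
  have e3 : ‖(2 * Complex.I)⁻¹‖ = 1 / 2 := by simp
  rw [e2, norm_mul, e3]
  have h4 := norm_sub_le (inner ℂ v (D u)) (inner ℂ (D v) u)
  have h5 := hDuv v u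
  have h6 := hDuv u v
  rw [norm_inner_symm] at h6
  have h7 : ‖A - B‖ / (4 * h) = 1 / 2 * (‖A - B‖ / (2 * h)) := by field_simp; norm_num
  rw [h7]
  nlinarith

theorem integrable_cfc_mul_poissonKernel (hh : 0 < h) (hA : IsSelfAdjoint A) {F : ℝ → ℂ}
    (hF : Continuous F) {M : ℝ} (hM : ∀ t, ‖F t‖ ≤ M) :
    Integrable (fun y => cfc (fun z : ℂ => F y * (poissonKernel h y z.re : ℂ)) A) ∧
      cfc (fun z : ℂ => ∫ y, F y * (poissonKernel h y z.re : ℂ)) A =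
        ∫ y, cfc (fun z : ℂ => F y * (poissonKernel h y z.re : ℂ)) A := by
  have hM0 : 0 ≤ M := (norm_nonneg _).trans (hM 0)
  have := hA.isStarNormal
  obtain ⟨C, hC⟩ := (spectrum.isCompact (𝕜 := ℂ) A).isBounded.exists_norm_le
  have hcont : ContinuousOn (Function.uncurry fun (y : ℝ) (z : ℂ) =>
      F y * (poissonKernel h y z.re : ℂ)) (Set.univ ×ˢ spectrum ℂ A) :=
    ((hF.comp continuous_fst).mul
      (Complex.continuous_ofReal.comp (continuous_poissonKernel hh))).continuousOn
  -- The constant comes from `y² ≤ 2(x - y)² + 2C²` for `|x| ≤ C`; it gives an integrable majorant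
  -- uniform over the spectrum.
  set K := h⁻¹ * (2 * h ^ 2 + 2 * C ^ 2 + 1) with hK
  have hbound : ∀ y : ℝ, ∀ z ∈ spectrum ℂ A,
      ‖F y * (poissonKernel h y z.re : ℂ)‖ ≤ M * (K * (1 + y ^ 2)⁻¹) := by
    intro y z hz
    rw [norm_mul, Complex.norm_real, Real.norm_of_nonneg (poissonKernel_nonneg y hh _)]
    refine mul_le_mul (hM y) ?_ (poissonKernel_nonneg y hh _) hM0
    have h1 : z.re ^ 2 ≤ C ^ 2 := by
      rw [← sq_abs z.re]
      exact pow_le_pow_left₀ (abs_nonneg _) ((Complex.abs_re_le_norm z).trans (hC z hz)) 2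
    rw [poissonKernel, hK, ← div_eq_mul_inv, div_le_div_iff₀ (by positivity) (by positivity),
      mul_assoc, ← mul_le_mul_iff_right₀ hh, ← mul_assoc h h⁻¹, mul_inv_cancel₀ hh.ne', one_mul]
    have h2 : y ^ 2 ≤ 2 * (z.re - y) ^ 2 + 2 * z.re ^ 2 := by nlinarith [sq_nonneg (2 * z.re - y)]
    have h3 : h ^ 2 * y ^ 2 ≤ h ^ 2 * (2 * (z.re - y) ^ 2 + 2 * C ^ 2) :=
      mul_le_mul_of_nonneg_left (by linarith) (sq_nonneg _)
    nlinarith [sq_nonneg h, mul_nonneg (sq_nonneg C) (sq_nonneg (z.re - y)), sq_nonneg (z.re - y),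
      mul_nonneg (sq_nonneg h) (sq_nonneg (z.re - y)), mul_nonneg (sq_nonneg h) (sq_nonneg h),
      mul_nonneg (sq_nonneg C) (sq_nonneg h)]
  have hint : Integrable fun y : ℝ => M * (K * (1 + y ^ 2)⁻¹) :=
    (integrable_inv_one_add_sq.const_mul K).const_mul M
  exact ⟨integrable_cfc _ _ A hcont (Eventually.of_forall hbound) hint.hasFiniteIntegral,
    cfc_integral _ _ A hcont (Eventually.of_forall hbound) hint.hasFiniteIntegral⟩

/-- The kernel has total mass `π` in `y` at every point of the spectrum, so integrating inside the
calculus gives the constant function `π`. -/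
theorem integral_inner_cfc_poissonKernel (hh : 0 < h) (hA : IsSelfAdjoint A) (u : H) :
    Integrable (fun y => (inner ℂ u (cfc (fun z : ℂ => (poissonKernel h y z.re : ℂ)) A u)).re) ∧
      ∫ y, (inner ℂ u (cfc (fun z : ℂ => (poissonKernel h y z.re : ℂ)) A u)).re =
        Real.pi * ‖u‖ ^ 2 := by
  have := hA.isStarNormal
  obtain ⟨h1, h2⟩ := integrable_cfc_mul_poissonKernel hh hA (F := fun _ => 1) continuous_const
    (M := 1) (fun _ => by simp)
  simp only [one_mul, integral_poissonKernel hh, cfc_const _ A] at h1 h2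
  set ℓ : (H →L[ℂ] H) →L[ℂ] ℂ := innerSL ℂ u ∘L ContinuousLinearMap.apply ℂ H u with hℓ
  have h3 : Integrable fun y => ℓ (cfc (fun z : ℂ => (poissonKernel h y z.re : ℂ)) A) :=
    ℓ.integrable_comp h1
  have h4 := ℓ.integral_comp_comm h1
  refine ⟨h3.re, ?_⟩
  have h5 := integral_re h3
  have h6 : ℓ (algebraMap ℂ (H →L[ℂ] H) Real.pi) = ((Real.pi * ‖u‖ ^ 2 : ℝ) : ℂ) := by
    rw [Algebra.algebraMap_eq_smul_one, map_smul]
    change (Real.pi : ℂ) * inner ℂ u u = _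
    rw [inner_self_eq_norm_sq_to_K]
    push_cast
    rfl
  rw [h4, ← h2, h6] at h5
  exact h5

/-- Poisson integrals of bounded functions are operator Lipschitz. -/
theorem norm_cfc_poisson_sub_le (hh : 0 < h) (hA : IsSelfAdjoint A) (hB : IsSelfAdjoint B)
    {F : ℝ → ℂ} (hF : Continuous F) {M : ℝ} (hM : ∀ t, ‖F t‖ ≤ M) :
    ‖cfc (fun z : ℂ => ∫ y, F y * (poissonKernel h y z.re : ℂ)) A -
      cfc (fun z : ℂ => ∫ y, F y * (poissonKernel h y z.re : ℂ)) B‖ ≤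
      Real.pi * (M / h * ‖A - B‖) := by
  have hM0 : 0 ≤ M := (norm_nonneg _).trans (hM 0)
  obtain ⟨a1, a2⟩ := integrable_cfc_mul_poissonKernel hh hA hF hM
  obtain ⟨b1, b2⟩ := integrable_cfc_mul_poissonKernel hh hB hF hM
  rw [a2, b2, ← integral_sub a1 b1]
  refine opNorm_le_of_forall_norm_inner_le (by have := Real.pi_pos; positivity) fun u v => ?_
  set ℓ : (H →L[ℂ] H) →L[ℂ] ℂ := innerSL ℂ v ∘L ContinuousLinearMap.apply ℂ H u with hℓ
  have h4 := ℓ.integral_comp_comm (a1.sub b1)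
  change ‖ℓ _‖ ≤ _
  refine (congrArg norm h4).symm.trans_le ?_
  obtain ⟨i1, j1⟩ := integral_inner_cfc_poissonKernel hh hA v
  obtain ⟨i2, j2⟩ := integral_inner_cfc_poissonKernel hh hB u
  obtain ⟨i3, j3⟩ := integral_inner_cfc_poissonKernel hh hB v
  obtain ⟨i4, j4⟩ := integral_inner_cfc_poissonKernel hh hA u
  refine (norm_integral_le_of_norm_le ((((i1.add i2).add (i3.add i4)).const_mul
    (‖A - B‖ / (4 * h))).const_mul M) (Eventually.of_forall fun y => ?_)).trans (le_of_eq ?_)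
  · have e : ∀ T : H →L[ℂ] H, cfc (fun z : ℂ => F y * (poissonKernel h y z.re : ℂ)) T =
        F y • cfc (fun z : ℂ => (poissonKernel h y z.re : ℂ)) T := fun T =>
      cfc_const_mul (R := ℂ) _ _ T (continuous_poissonKernel_re hh y).continuousOn
    simp only [Pi.sub_apply, e]
    rw [← smul_sub, map_smul, norm_smul]
    exact mul_le_mul (hM y) (norm_inner_cfc_poissonKernel_sub_le hh hA hB y u v) (norm_nonneg _) hM0
  -- The four forms integrate to `2π(‖u‖² + ‖v‖²)`; the factor `M‖A - B‖/(4h)` then gives exactly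
  -- `c/2` with `c = πM‖A - B‖/h`.
  · rw [integral_const_mul, integral_const_mul, integral_add' (i1.add i2) (i3.add i4),
      integral_add' i1 i2, integral_add' i3 i4, j1, j2, j3, j4]
    field_simp
    ring

end Operators

theorem uniformlyOperatorContinuous_of_bounded (f : C(ℝ, ℂ)) (hb : ∃ M : ℝ, ∀ t : ℝ, ‖f t‖ ≤ M)
    (hf : UniformContinuous f) : UniformlyOperatorContinuous.{u} f := by
  obtain ⟨M, hM⟩ := hb
  intro ε hε
  obtain ⟨h, hh, hfh⟩ := exists_poisson_approx hf hM (show 0 < ε / 4 by positivity)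
  have hM0 : 0 ≤ M := (norm_nonneg _).trans (hM 0)
  -- This `δ` makes the Lipschitz term at most `ε/4`. With two approximation errors of `ε/4` the
  -- total is `3ε/4`, all multiplied by `π` as the kernel is not normalized.
  refine ⟨ε * h / (4 * (M + 1)), by positivity, fun H _ _ _ A B hA hB hAB => ?_⟩
  set g : ℂ → ℂ := fun z => ∫ y, f y * (poissonKernel h y z.re : ℂ) with hg
  have hgc : Continuous g :=
    (continuous_integral_mul_poissonKernel hh f.continuous hM).comp Complex.continuous_re
  have hfc : Continuous fun z : ℂ => (Real.pi : ℂ) * f z.re := by fun_prop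
  have happ : ∀ S : H →L[ℂ] H, IsSelfAdjoint S →
      ‖cfc g S - (Real.pi : ℂ) • fcBounded f S‖ ≤ Real.pi * (ε / 4) := by
    intro S hS
    have e : (Real.pi : ℂ) • fcBounded f S = cfc (fun z : ℂ => (Real.pi : ℂ) * f z.re) S :=
      (cfc_const_mul (R := ℂ) _ _ S (by fun_prop)).symm
    rw [e, ← cfc_sub (R := ℂ) (a := S) _ _ hgc.continuousOn hfc.continuousOn]
    exact norm_cfc_le (by have := Real.pi_pos; positivity) fun z _ => hfh z.re
  have h1 := happ A hA
  have h2 := happ B hB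
  have h3 := norm_cfc_poisson_sub_le hh hA hB f.continuous hM
  have h4 : M / h * ‖A - B‖ ≤ ε / 4 := by
    have h5 : M / h * ‖A - B‖ ≤ M / h * (ε * h / (4 * (M + 1))) := by gcongr
    refine h5.trans ?_
    have h6 : M / h * (ε * h / (4 * (M + 1))) = M * ε / (4 * (M + 1)) := by field_simp
    rw [h6, div_le_div_iff₀ (by positivity) (by positivity)]
    nlinarith
  have h7 : Real.pi * ‖fcBounded f A - fcBounded f B‖ ≤ Real.pi * (3 * ε / 4) := by
    have e : (Real.pi : ℂ) • (fcBounded f A - fcBounded f B) =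
        (cfc g A - cfc g B) - (cfc g A - (Real.pi : ℂ) • fcBounded f A) +
          (cfc g B - (Real.pi : ℂ) • fcBounded f B) := by
      rw [smul_sub]; abel
    have e2 : Real.pi * ‖fcBounded f A - fcBounded f B‖ =
        ‖(Real.pi : ℂ) • (fcBounded f A - fcBounded f B)‖ := by
      rw [norm_smul, Complex.norm_real, Real.norm_of_nonneg Real.pi_pos.le]
    rw [e2, e]
    have h8 : Real.pi * (M / h * ‖A - B‖) ≤ Real.pi * (ε / 4) :=
      mul_le_mul_of_nonneg_left h4 Real.pi_pos.le
    calc _ ≤ ‖cfc g A - cfc g B‖ + ‖cfc g A - (Real.pi : ℂ) • fcBounded f A‖ +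
          ‖cfc g B - (Real.pi : ℂ) • fcBounded f B‖ :=
          (norm_add_le _ _).trans (by gcongr; exact norm_sub_le _ _)
      _ ≤ Real.pi * (ε / 4) + Real.pi * (ε / 4) + Real.pi * (ε / 4) := by
          gcongr; exact h3.trans h8
      _ = _ := by ring
  have h9 := le_of_mul_le_mul_left h7 Real.pi_pos
  linarith

end OperatorModulus
end

theorem corollary8p7 (f : C(ℝ, ℂ)) :
    (OperatorModulus.OperatorContinuous.{u} f ↔
      OperatorModulus.UniformlyOperatorContinuous.{u} f) ∧
    ((∃ M : ℝ, ∀ t : ℝ, ‖f t‖ ≤ M) → UniformContinuous f →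
      OperatorModulus.UniformlyOperatorContinuous.{u} f) ∧
    (∀ (H : Type u) [NormedAddCommGroup H] [InnerProductSpace ℂ H] [CompleteSpace H]
      (A B : H →ₗ.[ℂ] H) (hA : IsSelfAdjoint A) (hB : IsSelfAdjoint B) (K : H →L[ℂ] H),
      A = (K : H →ₗ[ℂ] H) +ᵥ B →
        OperatorModulus.normDiff (OperatorModulus.fc f A hA) (OperatorModulus.fc f B hB) ≤
          OperatorModulus.operatorModulus.{u} f ‖K‖) :=
  ⟨⟨fun h => h.uniformlyOperatorContinuous, fun h => h.operatorContinuous⟩,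
    OperatorModulus.uniformlyOperatorContinuous_of_bounded f,
    fun _ _ _ _ _ _ hA hB _ h => OperatorModulus.normDiff_fc_le_operatorModulus f hA hB h⟩
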